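/- Let $(T_n)_{n\ge 1}$ be the plane-oriented recursive tree: $T_1$ is a single node, $T_2$ is a single edge, and for $n\ge 2$ the tree $T_{n+1}$ is obtained from $T_n$ by adding a new node joined by an edge to a random node of $T_n$, node $v$ being chosen, given the past, with probability $\deg_{T_n}(v)/\sum_u \deg_{T_n}(u)$. Let $Z_n=\sum_{v}\deg_{T_n}(v)^2$ be the Zagreb index of $T_n$, and write $\zeta(3)=\sum_{k\ge 1}k^{-3}$. Then: (1) The third central moment of $Z_n$ is of exact order $n^3$: $$\lim_{n\to\infty}\frac{\mathbb{E}[Z_n^3]-3\,\mathbb{E}[Z_n]\,\mathbb{E}[Z_n^2]+2\,(\mathbb{E}[Z_n])^3}{n^3}=28+16\,\zeta(3).$$ (2) $Z_n$ is asymptotically skewed to the right: its skewness converges to a positive constant, $$\lim_{n\to\infty}\mathbb{E}\left[\left(\frac{Z_n-\mathbb{E}[Z_n]}{\sqrt{\mathrm{Var}(Z_n)}}\right)^{3}\right]=\frac{28+16\,\zeta(3)}{\left(16-2\pi^2/3\right)^{3/2}}=:s,\qquad 1.633<s<1.634.$$ (3) The limit law is not normal: $(Z_n-\mathbb{E}[Z_n])/\sqrt{\mathrm{Var}(Z_n)}$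 converges in distribution to a probability law $\nu$ on $\mathbb{R}$ which has a finite third absolute moment and skewness $s$, and $\nu$ is not a normal law (of any mean and variance, a point mass included). -/

import Mathlib

open MeasureTheory ProbabilityTheory Filter Topology
open scoped ENNReal

noncomputable section

namespace Port

open scoped Classical in
/-- The Zagreb index of a finite graph: the sum of the squared degrees of its nodes. -/
def zagrebIndex {V : Type*} [Fintype V] (G : SimpleGraph V) : ℕ :=
  ∑ v, G.degree v ^ 2

/-- The graph obtained from `G` by adding one new node (the last one) together with one edge
joining it to the old node `v`. -/
def attachLeaf {n : ℕ} (G : SimpleGraph (Fin n)) (v : Fin n) : SimpleGraph (Fin (n + 1)) :=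
  G.map Fin.castSuccEmb ⊔ SimpleGraph.edge v.castSucc (Fin.last n)

open scoped Classical in
/-- The law of the parent of the next newcomer: node `v` is chosen with probability
`deg v / ∑ u, deg u`. While all degrees vanish (for the growing tree this happens only at time 1,
when the unique node is the only candidate) the quotient is `0 / 0`, and the parent is chosen
uniformly. -/
def parentLaw {n : ℕ} (G : SimpleGraph (Fin (n + 1))) : PMF (Fin (n + 1)) :=
  if h : ∑ u, G.degree u = 0 then PMF.uniformOfFintype (Fin (n + 1))
  else PMF.ofFintype (fun v => (G.degree v : ℝ≥0∞) / ((∑ u, G.degree u : ℕ) : ℝ≥0∞)) (by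
    simp only [div_eq_mul_inv]
    rw [← Finset.sum_mul, ← Nat.cast_sum]
    exact ENNReal.mul_inv_cancel (by exact_mod_cast h) (ENNReal.natCast_ne_top _))

/-- The law of the random tree `T_n` on the nodes `0, …, n - 1`, labelled by order of appearance:
`T_1` is a single node, and at each later time a newcomer is attached to a node of the current
tree chosen according to `parentLaw`. (The case `n = 0` is a placeholder.) -/
def treeLaw : (n : ℕ) → PMF (SimpleGraph (Fin n))
  | 0 => PMF.pure ⊥
  | 1 => PMF.pure ⊥
  | n + 2 => (treeLaw (n + 1)).bind fun G => (parentLaw G).map (attachLeaf G)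

/-- The law of the Zagreb index `Z_n` of `T_n`, as a probability measure on `ℝ`. -/
def zagrebLaw (n : ℕ) : Measure ℝ :=
  ((treeLaw n).map fun G => (zagrebIndex G : ℝ)).toMeasure

instance (n : ℕ) : IsProbabilityMeasure (zagrebLaw n) := by
  unfold zagrebLaw; infer_instance

/-- The map `x ↦ (x - m) / σ`, with `m` and `σ` the mean and the standard deviation of `μ`. -/
def standardize (μ : Measure ℝ) (x : ℝ) : ℝ :=
  (x - ∫ y, y ∂μ) / √(variance id μ)

lemma measurable_standardize (μ : Measure ℝ) : Measurable (standardize μ) := by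
  unfold standardize; fun_prop

/-- The skewness of a law on `ℝ`: its standardized third central moment. -/
def skewness (μ : Measure ℝ) : ℝ :=
  ∫ x, standardize μ x ^ 3 ∂μ

/-- The law of the standardized Zagreb index `(Z_n - E Z_n) / √(Var Z_n)`. -/
def standardizedZagrebLaw (n : ℕ) : ProbabilityMeasure ℝ :=
  ⟨(zagrebLaw n).map (standardize (zagrebLaw n)),
    Measure.isProbabilityMeasure_map (measurable_standardize _).aemeasurable⟩

/-- Apéry's constant `ζ(3)`. -/
def zetaThree : ℝ := ∑' k : ℕ, 1 / ((k : ℝ) + 1) ^ 3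

/-- The limiting skewness of the Zagreb index. -/
def limitSkewness : ℝ := (28 + 16 * zetaThree) / (16 - 2 * Real.pi ^ 2 / 3) ^ (3 / 2 : ℝ)

end Port

end

/-! Given T_n, the parent of the newcomer has the size-biased degree law, so E[Z_{n+1} | T_n] =
(n/(n-1)) Z_n + 2. Hence M = Z_n/(n-1) - 2H_{n-1} (`mart`, with n = i + 2) is a centred martingale,
and the k-th central moment of Z_n is (n-1)^k E[M^k].

A size-biased average of deg^k is the (k+1)-st power sum of the degrees over 2(n-1), so conditional
moments of M bring in higher power sums. Rising factorial moments of the degrees have autonomous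
mean recursions, and with them the recursions for E[M^2], E[M `rising3`] and E[M^3] form a closed
triangular system. It is solved explicitly by harmonic sums and the product `growth`
(`treeMean_mart_sq`, `treeMean_mart_cube`). Since `growth` is O(n^{3/2}), its terms vanish after
normalization, leaving Var M → 16 - 4ζ(2) and E[M^3] → 28 + 16ζ(3).

For the limit law, no common probability space is needed: an increment of M has conditional mean
zero and conditional variance at most 2 `rising3`/(n-1)^3, so consecutive characteristic functions
differ by O(t^2 n^{-3/2}) and converge (`exists_tendsto_martChar`). The fourth moment of M stays
bounded (`exists_treeMean_mart_fourth_le`); this gives tightness, hence a limit law, and carries the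
first three moments to the limit. The limit has skewness s > 0, while every normal law has skewness
0 by reflection. -/

noncomputable section

namespace Port

/-! ### Expectations under laws on finite types -/

section PMFMean

variable {α β E : Type*} [Fintype α] [Fintype β] [AddCommGroup E] [Module ℝ E]

/-- The expectation of `F` under a law on a finite type. -/
def pmfMean (p : PMF α) (F : α → E) : E := ∑ a, (p a).toReal • F a

lemma pmfMean_pure (a : α) (F : α → E) : pmfMean (PMF.pure a) F = F a := by
  classical
  simp only [pmfMean, PMF.pure_apply]
  rw [Finset.sum_eq_single a] <;> simp +contextual

lemma pmfMean_bind (p : PMF α) (q : α → PMF β) (F : β → E) :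
    pmfMean (p.bind q) F = pmfMean p fun a => pmfMean (q a) F := by
  simp only [pmfMean, PMF.bind_apply, tsum_fintype, Finset.smul_sum]
  rw [Finset.sum_comm]
  refine Finset.sum_congr rfl fun b _ => ?_
  rw [ENNReal.toReal_sum fun a _ => ENNReal.mul_ne_top (p.apply_ne_top a) ((q a).apply_ne_top b),
    Finset.sum_smul]
  simp [mul_smul]

lemma pmfMean_map (p : PMF α) (g : α → β) (F : β → E) :
    pmfMean (p.map g) F = pmfMean p (F ∘ g) := by
  rw [← PMF.bind_pure_comp, pmfMean_bind]
  simp [pmfMean_pure, Function.comp_def]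

lemma pmfMean_congr {p : PMF α} {F F' : α → E} (h : ∀ a ∈ p.support, F a = F' a) :
    pmfMean p F = pmfMean p F' := by
  refine Finset.sum_congr rfl fun a _ => ?_
  by_cases ha : p a = 0
  · simp [ha]
  · rw [h a ha]

lemma pmfMean_add (p : PMF α) (F F' : α → E) :
    pmfMean p (fun a => F a + F' a) = pmfMean p F + pmfMean p F' := by
  simp [pmfMean, Finset.sum_add_distrib]

lemma pmfMean_sub (p : PMF α) (F F' : α → E) :
    pmfMean p (fun a => F a - F' a) = pmfMean p F - pmfMean p F' := by
  simp [pmfMean, smul_sub, Finset.sum_sub_distrib]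

lemma pmfMean_const_mul (p : PMF α) (c : ℝ) (F : α → ℝ) :
    pmfMean p (fun a => c * F a) = c * pmfMean p F := by
  simp only [pmfMean, Finset.mul_sum, smul_eq_mul]
  exact Finset.sum_congr rfl fun a _ => by ring

lemma sum_toReal_eq_one (p : PMF α) : ∑ a, (p a).toReal = 1 := by
  rw [← ENNReal.toReal_sum fun a _ => p.apply_ne_top a, ← tsum_fintype (L := .unconditional α),
    p.tsum_coe, ENNReal.toReal_one]

lemma pmfMean_const (p : PMF α) (c : E) : pmfMean p (fun _ => c) = c := by
  rw [pmfMean, ← Finset.sum_smul, sum_toReal_eq_one, one_smul]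

lemma pmfMean_mono {p : PMF α} {F F' : α → ℝ} (h : ∀ a ∈ p.support, F a ≤ F' a) :
    pmfMean p F ≤ pmfMean p F' := by
  refine Finset.sum_le_sum fun a _ => ?_
  by_cases ha : p a = 0
  · simp [ha]
  · exact mul_le_mul_of_nonneg_left (h a ha) ENNReal.toReal_nonneg

lemma norm_pmfMean_le {E : Type*} [NormedAddCommGroup E] [NormedSpace ℝ E]
    (p : PMF α) (F : α → E) : ‖pmfMean p F‖ ≤ pmfMean p fun a => ‖F a‖ := by
  refine (norm_sum_le _ _).trans (Finset.sum_le_sum fun a _ => ?_)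
  rw [norm_smul, Real.norm_of_nonneg ENNReal.toReal_nonneg, smul_eq_mul]

lemma pmfMean_nonneg {p : PMF α} {F : α → ℝ} (h : ∀ a, 0 ≤ F a) : 0 ≤ pmfMean p F :=
  Finset.sum_nonneg fun a _ => mul_nonneg ENNReal.toReal_nonneg (h a)

end PMFMean

/-! ### The degrees of the tree after attaching a leaf -/

open scoped Classical in
/-- The sum of the values of `f` at the degrees of `G`. -/
def degSum {V : Type*} [Fintype V] (G : SimpleGraph V) (f : ℝ → ℝ) : ℝ :=
  ∑ v, f (G.degree v)

lemma attachLeaf_adj {n : ℕ} (G : SimpleGraph (Fin n)) (v : Fin n) (a b : Fin (n + 1)) :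
    (attachLeaf G v).Adj a b ↔
      (∃ x y, G.Adj x y ∧ Fin.castSuccEmb x = a ∧ Fin.castSuccEmb y = b) ∨
        ((v.castSucc = a ∧ Fin.last n = b ∨ v.castSucc = b ∧ Fin.last n = a) ∧ a ≠ b) := by
  rw [attachLeaf, SimpleGraph.sup_adj, SimpleGraph.map_adj, SimpleGraph.edge_adj]
  simp only [and_comm, eq_comm]

open scoped Classical in
lemma degree_attachLeaf_castSucc {n : ℕ} (G : SimpleGraph (Fin n)) (v u : Fin n) :
    (attachLeaf G v).degree u.castSucc = G.degree u + if u = v then 1 else 0 := by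
  have h : (attachLeaf G v).neighborFinset u.castSucc =
      (G.neighborFinset u).map Fin.castSuccEmb ∪ if u = v then {Fin.last n} else ∅ := by
    ext w
    rw [SimpleGraph.mem_neighborFinset, attachLeaf_adj]
    induction w using Fin.lastCases with
    | last =>
      by_cases huv : u = v
      · simp [huv, Fin.castSucc_ne_last]
      · simp [huv, Ne.symm huv, Fin.castSucc_ne_last]
    | cast w =>
      by_cases huv : u = v
      · simp [huv, (Fin.castSucc_ne_last _).symm]
      · simp [huv, (Fin.castSucc_ne_last _).symm]
  rw [← SimpleGraph.card_neighborFinset_eq_degree, h, Finset.card_union_of_disjoint,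
    Finset.card_map, SimpleGraph.card_neighborFinset_eq_degree]
  · split_ifs <;> simp
  · split_ifs
    · simp [Fin.castSucc_ne_last]
    · simp

open scoped Classical in
lemma degree_attachLeaf_last {n : ℕ} (G : SimpleGraph (Fin n)) (v : Fin n) :
    (attachLeaf G v).degree (Fin.last n) = 1 := by
  have h : (attachLeaf G v).neighborFinset (Fin.last n) = {v.castSucc} := by
    ext w
    rw [SimpleGraph.mem_neighborFinset, attachLeaf_adj]
    induction w using Fin.lastCases with
    | last => simp [Fin.castSucc_ne_last, (Fin.castSucc_ne_last _).symm]
    | cast w => simp [Fin.castSucc_ne_last, (Fin.castSucc_ne_last _).symm, eq_comm]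
  rw [← SimpleGraph.card_neighborFinset_eq_degree, h, Finset.card_singleton]

open scoped Classical in
lemma degSum_attachLeaf {n : ℕ} (G : SimpleGraph (Fin n)) (v : Fin n) (f : ℝ → ℝ) :
    degSum (attachLeaf G v) f =
      degSum G f + (f (G.degree v + 1) - f (G.degree v)) + f 1 := by
  rw [degSum, Fin.sum_univ_castSucc, degree_attachLeaf_last, degSum, Nat.cast_one]
  congr 1
  have h : ∀ u : Fin n, f ((attachLeaf G v).degree u.castSucc) =
      f (G.degree u) + if u = v then f (G.degree v + 1) - f (G.degree v) else 0 := by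
    intro u
    rw [degree_attachLeaf_castSucc]
    by_cases huv : u = v
    · subst huv; simp
    · simp [huv]
  simp [h, Finset.sum_add_distrib]

/-- The sum of the `k`-th powers of the degrees of `G`. -/
def powSum {V : Type*} [Fintype V] (G : SimpleGraph V) (k : ℕ) : ℝ := degSum G (· ^ k)

lemma zagrebIndex_eq_powSum {V : Type*} [Fintype V] (G : SimpleGraph V) :
    (zagrebIndex G : ℝ) = powSum G 2 := by
  simp [zagrebIndex, powSum, degSum]

open scoped Classical in
lemma powSum_one {V : Type*} [Fintype V] (G : SimpleGraph V) :
    powSum G 1 = ((∑ v, G.degree v : ℕ) : ℝ) := by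
  simp [powSum, degSum]

lemma powSum_nonneg {V : Type*} [Fintype V] (G : SimpleGraph V) (k : ℕ) : 0 ≤ powSum G k :=
  Finset.sum_nonneg fun _ _ => by positivity

open scoped Classical in
lemma powSum_attachLeaf {n : ℕ} (G : SimpleGraph (Fin n)) (v : Fin n) (k : ℕ) :
    powSum (attachLeaf G v) k =
      powSum G k + (((G.degree v : ℝ) + 1) ^ k - (G.degree v : ℝ) ^ k) + 1 := by
  simp [powSum, degSum_attachLeaf]

/-! ### One step of the growth -/

open scoped Classical in
lemma pmfMean_parentLaw {n : ℕ} {E : Type*} [AddCommGroup E] [Module ℝ E]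
    (G : SimpleGraph (Fin (n + 1))) (h : powSum G 1 ≠ 0)
    (F : Fin (n + 1) → E) :
    pmfMean (parentLaw G) F = ∑ v, ((G.degree v : ℝ) / powSum G 1) • F v := by
  rw [powSum_one] at h ⊢
  have h' : ¬ ∑ u, G.degree u = 0 := by exact_mod_cast h
  rw [pmfMean, parentLaw, dif_neg h']
  refine Finset.sum_congr rfl fun v _ => ?_
  rw [PMF.ofFintype_apply, ENNReal.toReal_div, ENNReal.toReal_natCast, ENNReal.toReal_natCast]

/-- The newcomer and its parent each gain one degree. Of the shape of the trees, the later averages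
use only this deterministic normalizer. -/
lemma powSum_one_of_mem_support : ∀ (n : ℕ) (G : SimpleGraph (Fin (n + 1))),
    G ∈ (treeLaw (n + 1)).support → powSum G 1 = 2 * n
  | 0, G, hG => by
    have : G = ⊥ := by simpa [treeLaw] using hG
    subst this
    simp [powSum, degSum]
  | n + 1, G, hG => by
    obtain ⟨G', hG', v, -, rfl⟩ : ∃ G' ∈ (treeLaw (n + 1)).support, ∃ v ∈ (parentLaw G').support,
        attachLeaf G' v = G := by
      simpa [treeLaw, PMF.mem_support_bind_iff, PMF.mem_support_map_iff] using hG
    rw [powSum_attachLeaf, powSum_one_of_mem_support n G' hG']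
    push_cast
    ring

/-- The expectation of `F` over the tree with `i + 2` nodes. -/
def treeMean {E : Type*} [AddCommGroup E] [Module ℝ E] (i : ℕ)
    (F : SimpleGraph (Fin (i + 2)) → E) : E := pmfMean (treeLaw (i + 2)) F

open scoped Classical in
/-- The average of `F` over the choice of the parent of the next newcomer. -/
def stepMean {n : ℕ} {E : Type*} [AddCommGroup E] [Module ℝ E] (G : SimpleGraph (Fin (n + 2)))
    (F : Fin (n + 2) → E) : E :=
  ∑ v, ((G.degree v : ℝ) / (2 * (n + 1))) • F v

lemma powSum_one_of_mem {i : ℕ} {G : SimpleGraph (Fin (i + 2))}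
    (hG : G ∈ (treeLaw (i + 2)).support) : powSum G 1 = 2 * (i + 1) := by
  have := powSum_one_of_mem_support (i + 1) G hG
  push_cast at this
  exact this

lemma treeMean_succ {E : Type*} [AddCommGroup E] [Module ℝ E] (i : ℕ)
    (F : SimpleGraph (Fin (i + 3)) → E) :
    treeMean (i + 1) F = treeMean i fun G => stepMean G fun v => F (attachLeaf G v) := by
  rw [treeMean, treeLaw, pmfMean_bind, treeMean]
  refine pmfMean_congr fun G hG => ?_
  have h1 := powSum_one_of_mem hG
  -- From two nodes on the degree sum is positive, so the uniform fallback in `parentLaw` does not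
  -- occur.
  rw [pmfMean_map, pmfMean_parentLaw G (by rw [h1]; positivity), h1]
  rfl

lemma treeMean_zero {E : Type*} [AddCommGroup E] [Module ℝ E]
    (F : SimpleGraph (Fin 2) → E) : treeMean 0 F = F (attachLeaf ⊥ 0) := by
  rw [treeMean, treeLaw, treeLaw, PMF.pure_bind, pmfMean_map, pmfMean]
  simp only [Fin.sum_univ_succ, Function.comp_apply]
  -- At time 1 there is a single candidate parent, so total mass one fixes its probability.
  have := sum_toReal_eq_one (parentLaw (⊥ : SimpleGraph (Fin (0 + 1))))
  simp only [Fin.sum_univ_succ] at this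
  simp at this ⊢
  simp [this]

lemma powSum_zero_tree {k : ℕ} (hk : k ≠ 0) :
    powSum (attachLeaf (⊥ : SimpleGraph (Fin 1)) 0) k = 2 := by
  rw [powSum_attachLeaf]
  simp [powSum, degSum, hk]
  norm_num

/-! ### Exact moments of the normalized Zagreb index -/

/-- The generalized harmonic number `∑ j ≤ i + 1, j⁻ᵏ`. -/
def harm (k i : ℕ) : ℝ := ∑ j ∈ Finset.range (i + 1), 1 / ((j : ℝ) + 1) ^ k

/-- The sum `1/3 + 1/5 + ⋯` with `i + 1` terms. -/
def oddHarm (i : ℕ) : ℝ := ∑ j ∈ Finset.range (i + 1), 1 / (2 * (j : ℝ) + 3)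

/-- The growth factor of the third rising factorial moment of the degrees. -/
def growth (i : ℕ) : ℝ := ∏ j ∈ Finset.range i, (1 + 3 / (2 * ((j : ℝ) + 1)))

lemma harm_succ (k i : ℕ) : harm k (i + 1) = harm k i + 1 / ((i : ℝ) + 2) ^ k := by
  rw [harm, Finset.sum_range_succ, ← harm]
  push_cast
  ring

lemma oddHarm_succ (i : ℕ) : oddHarm (i + 1) = oddHarm i + 1 / (2 * (i : ℝ) + 5) := by
  rw [oddHarm, Finset.sum_range_succ, ← oddHarm]
  push_cast
  ring

lemma growth_succ (i : ℕ) : growth (i + 1) = growth i * (1 + 3 / (2 * ((i : ℝ) + 1))) := by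
  rw [growth, Finset.prod_range_succ, ← growth]

/-- The martingale `Z_n / (n - 1) - 2 H_{n - 1}` for `n = i + 2`. -/
def mart (i : ℕ) (G : SimpleGraph (Fin (i + 2))) : ℝ := powSum G 2 / (i + 1) - 2 * harm 1 i

/-- The third rising factorial moment of the degrees, shifted so that its mean grows
multiplicatively. -/
def rising3 (i : ℕ) (G : SimpleGraph (Fin (i + 2))) : ℝ :=
  powSum G 3 + 3 * powSum G 2 + 16 * (i + 1)

/-- The fourth rising factorial moment of the degrees. -/
def rising4 (i : ℕ) (G : SimpleGraph (Fin (i + 2))) : ℝ :=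
  powSum G 4 + 6 * powSum G 3 + 11 * powSum G 2 + 12 * (i + 1)

/-- The fifth rising factorial moment of the degrees. -/
def rising5 (i : ℕ) (G : SimpleGraph (Fin (i + 2))) : ℝ :=
  powSum G 5 + 10 * powSum G 4 + 35 * powSum G 3 + 50 * powSum G 2 + 48 * (i + 1)

-- Choosing `v` with weight proportional to its degree raises each exponent by one: the mean of
-- deg^k is `powSum G (k + 1) / (2 * (n + 1))`. Degree four suffices for every moment computed
-- below.
open scoped Classical in
lemma stepMean_eq_of_quartic {n : ℕ} (G : SimpleGraph (Fin (n + 2)))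
    (h1 : powSum G 1 = 2 * (n + 1))
    {F : Fin (n + 2) → ℝ} (c₀ c₁ c₂ c₃ c₄ : ℝ)
    (hF : ∀ v, F v = c₀ + c₁ * G.degree v + c₂ * (G.degree v : ℝ) ^ 2 + c₃ * (G.degree v : ℝ) ^ 3
      + c₄ * (G.degree v : ℝ) ^ 4) :
    stepMean G F = c₀ + (c₁ * powSum G 2 + c₂ * powSum G 3 + c₃ * powSum G 4 + c₄ * powSum G 5)
      / (2 * (n + 1)) := by
  have hc : c₀ = c₀ * powSum G 1 / (2 * (n + 1)) := by
    rw [h1]; field_simp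
  rw [hc, ← add_div]
  simp only [stepMean, smul_eq_mul, powSum, degSum, Finset.mul_sum, ← Finset.sum_add_distrib,
    Finset.sum_div]
  refine Finset.sum_congr rfl fun v _ => ?_
  rw [hF]
  ring

open scoped Classical in
lemma mart_attachLeaf {i : ℕ} (G : SimpleGraph (Fin (i + 2))) (v : Fin (i + 2)) :
    mart (i + 1) (attachLeaf G v) =
      ((powSum G 2 + 2) / (i + 2) - 2 * harm 1 (i + 1)) + 2 / (i + 2) * G.degree v := by
  rw [mart, powSum_attachLeaf]
  push_cast
  ring

open scoped Classical in
lemma rising3_attachLeaf {i : ℕ} (G : SimpleGraph (Fin (i + 2))) (v : Fin (i + 2)) :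
    rising3 (i + 1) (attachLeaf G v) =
      rising3 i G + 24 + 9 * G.degree v + 3 * (G.degree v : ℝ) ^ 2 := by
  rw [rising3, powSum_attachLeaf, powSum_attachLeaf, rising3]
  push_cast
  ring

open scoped Classical in
lemma rising4_attachLeaf {i : ℕ} (G : SimpleGraph (Fin (i + 2))) (v : Fin (i + 2)) :
    rising4 (i + 1) (attachLeaf G v) =
      rising4 i G + 48 + 44 * G.degree v + 24 * (G.degree v : ℝ) ^ 2 + 4 * (G.degree v : ℝ) ^ 3 := by
  rw [rising4, powSum_attachLeaf, powSum_attachLeaf, powSum_attachLeaf, rising4]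
  push_cast
  ring

open scoped Classical in
lemma rising5_attachLeaf {i : ℕ} (G : SimpleGraph (Fin (i + 2))) (v : Fin (i + 2)) :
    rising5 (i + 1) (attachLeaf G v) =
      rising5 i G + 240 + 250 * G.degree v + 175 * (G.degree v : ℝ) ^ 2
        + 50 * (G.degree v : ℝ) ^ 3 + 5 * (G.degree v : ℝ) ^ 4 := by
  rw [rising5, powSum_attachLeaf, powSum_attachLeaf, powSum_attachLeaf, powSum_attachLeaf, rising5]
  push_cast
  ring

/-! ### Conditional one-step recursions -/

section Step

variable {i : ℕ} {G : SimpleGraph (Fin (i + 2))}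

lemma two_ne (i : ℕ) : (i : ℝ) + 2 ≠ 0 := by positivity

lemma step_mart (h1 : powSum G 1 = 2 * (i + 1)) :
    stepMean G (fun v => mart (i + 1) (attachLeaf G v)) = mart i G := by
  rw [stepMean_eq_of_quartic G h1 _ _ 0 0 0
    (fun v => by rw [mart_attachLeaf]; simp only [zero_mul, add_zero]; rfl)]
  have := two_ne i
  rw [mart, harm_succ]
  field_simp
  ring

/-- The forward difference of d(d+1)(d+2) is 3(d+1)(d+2), whose size-biased mean is again a rising
factorial moment. The plain moment has constant term 4(i+1) and would leave an additive 6; the extra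
12(i+1) absorbs it. -/
lemma step_rising3 (h1 : powSum G 1 = 2 * (i + 1)) :
    stepMean G (fun v => rising3 (i + 1) (attachLeaf G v)) =
      (1 + 3 / (2 * (i + 1))) * rising3 i G := by
  rw [stepMean_eq_of_quartic G h1 _ _ _ 0 0
    (fun v => by rw [rising3_attachLeaf]; simp only [zero_mul, add_zero]; rfl)]
  rw [rising3]
  field_simp
  ring

lemma step_rising4 (h1 : powSum G 1 = 2 * (i + 1)) :
    stepMean G (fun v => rising4 (i + 1) (attachLeaf G v)) =
      (1 + 2 / (i + 1)) * rising4 i G + 24 := by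
  rw [stepMean_eq_of_quartic G h1 _ _ _ _ 0
    (fun v => by rw [rising4_attachLeaf]; simp only [zero_mul, add_zero]; rfl)]
  rw [rising4]
  field_simp
  ring

lemma step_rising5 (h1 : powSum G 1 = 2 * (i + 1)) :
    stepMean G (fun v => rising5 (i + 1) (attachLeaf G v)) =
      (1 + 5 / (2 * (i + 1))) * rising5 i G + 120 := by
  rw [stepMean_eq_of_quartic G h1 _ _ _ _ _ (fun v => by rw [rising5_attachLeaf])]
  rw [rising5]
  field_simp
  ring

lemma step_mart_sq (h1 : powSum G 1 = 2 * (i + 1)) :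
    stepMean G (fun v => mart (i + 1) (attachLeaf G v) ^ 2) =
      (1 - 1 / (i + 2) ^ 2) * mart i G ^ 2
        + -(6 + 4 * harm 1 i) / (i + 2) ^ 2 * mart i G
        + 2 / ((i + 1) * (i + 2) ^ 2) * rising3 i G
        + -(12 * harm 1 i + 32 + 4 * harm 1 i ^ 2) / (i + 2) ^ 2 := by
  set α : ℝ := (powSum G 2 + 2) / (i + 2) - 2 * harm 1 (i + 1) with hα
  set β : ℝ := 2 / (i + 2) with hβ
  rw [stepMean_eq_of_quartic G h1 (α ^ 2) (2 * α * β) (β ^ 2) 0 0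
    (fun v => by rw [mart_attachLeaf]; ring)]
  have := two_ne i
  rw [mart, rising3, hα, hβ, harm_succ]
  field_simp
  ring

lemma step_mart_mul_rising3 (h1 : powSum G 1 = 2 * (i + 1)) :
    stepMean G (fun v => mart (i + 1) (attachLeaf G v) * rising3 (i + 1) (attachLeaf G v)) =
      (1 + 3 / (2 * (i + 2))) * (mart i G * rising3 i G)
        + 18 / (i + 2) * mart i G
        + -(9 + 3 * harm 1 i) / ((i + 1) * (i + 2)) * rising3 i G
        + 3 / ((i + 1) * (i + 2)) * rising4 i G
        + (36 * harm 1 i + 108) / (i + 2) := by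
  set α : ℝ := (powSum G 2 + 2) / (i + 2) - 2 * harm 1 (i + 1) with hα
  set β : ℝ := 2 / (i + 2) with hβ
  set γ : ℝ := rising3 i G + 24 with hγ
  rw [stepMean_eq_of_quartic G h1 (α * γ) (9 * α + β * γ) (3 * α + 9 * β) (3 * β) 0
    (fun v => by rw [mart_attachLeaf, rising3_attachLeaf]; ring)]
  have := two_ne i
  rw [hγ, mart, rising3, rising4, hα, hβ, harm_succ]
  field_simp
  ring

/-- Besides powers of `mart`, only `mart * rising3`, `rising3` and `rising4` occur, all with means
found separately; this is why the system closes. -/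
lemma step_mart_cube (h1 : powSum G 1 = 2 * (i + 1)) :
    stepMean G (fun v => mart (i + 1) (attachLeaf G v) ^ 3) =
      (1 - 3 / (i + 2) ^ 2 + 2 / (i + 2) ^ 3) * mart i G ^ 3
        + (-3 * (6 + 4 * harm 1 i) / (i + 2) ^ 2 + (18 + 12 * harm 1 i) / (i + 2) ^ 3)
          * mart i G ^ 2
        + (-3 * (12 * harm 1 i + 32 + 4 * harm 1 i ^ 2) / (i + 2) ^ 2
          + (124 + 72 * harm 1 i + 24 * harm 1 i ^ 2) / (i + 2) ^ 3) * mart i G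
        + (6 / ((i + 1) * (i + 2) ^ 2) - 6 / ((i + 1) * (i + 2) ^ 3)) * (mart i G * rising3 i G)
        + -(24 + 12 * harm 1 i) / ((i + 1) * (i + 2) ^ 3) * rising3 i G
        + 4 / ((i + 1) * (i + 2) ^ 3) * rising4 i G
        + (248 * harm 1 i + 336 + 72 * harm 1 i ^ 2 + 16 * harm 1 i ^ 3) / (i + 2) ^ 3 := by
  set α : ℝ := (powSum G 2 + 2) / (i + 2) - 2 * harm 1 (i + 1) with hα
  set β : ℝ := 2 / (i + 2) with hβ
  rw [stepMean_eq_of_quartic G h1 (α ^ 3) (3 * α ^ 2 * β) (3 * α * β ^ 2) (β ^ 3) 0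
    (fun v => by rw [mart_attachLeaf]; ring)]
  have := two_ne i
  rw [mart, rising3, rising4, hα, hβ, harm_succ]
  field_simp
  ring

end Step

/-! ### Solving the recursions for the means -/

lemma treeMean_congr {E : Type*} [AddCommGroup E] [Module ℝ E] {i : ℕ}
    {F F' : SimpleGraph (Fin (i + 2)) → E} (h : ∀ G, powSum G 1 = 2 * (i + 1) → F G = F' G) :
    treeMean i F = treeMean i F' :=
  pmfMean_congr fun G hG => h G (powSum_one_of_mem hG)

lemma treeMean_mono {i : ℕ} {F F' : SimpleGraph (Fin (i + 2)) → ℝ}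
    (h : ∀ G, powSum G 1 = 2 * (i + 1) → F G ≤ F' G) : treeMean i F ≤ treeMean i F' :=
  pmfMean_mono fun G hG => h G (powSum_one_of_mem hG)

lemma treeMean_add {i : ℕ} (F F' : SimpleGraph (Fin (i + 2)) → ℝ) :
    treeMean i (fun G => F G + F' G) = treeMean i F + treeMean i F' := pmfMean_add _ F F'

lemma treeMean_const_mul {i : ℕ} (c : ℝ) (F : SimpleGraph (Fin (i + 2)) → ℝ) :
    treeMean i (fun G => c * F G) = c * treeMean i F := pmfMean_const_mul _ c F

lemma treeMean_const {i : ℕ} (c : ℝ) : treeMean i (fun _ => c) = c := pmfMean_const _ c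

lemma treeMean_nonneg {i : ℕ} {F : SimpleGraph (Fin (i + 2)) → ℝ} (h : ∀ G, 0 ≤ F G) :
    0 ≤ treeMean i F := pmfMean_nonneg h

lemma treeMean_mart (i : ℕ) : treeMean i (mart i) = 0 := by
  induction i with
  | zero =>
    rw [treeMean_zero, mart, powSum_zero_tree two_ne_zero]
    simp [harm]
  | succ i ih =>
    rw [treeMean_succ, treeMean_congr fun G hG => step_mart hG]
    exact ih

lemma treeMean_rising3 (i : ℕ) : treeMean i (rising3 i) = 24 * growth i := by
  induction i with
  | zero =>
    rw [treeMean_zero, rising3, powSum_zero_tree two_ne_zero, powSum_zero_tree three_ne_zero]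
    simp [growth]
    norm_num
  | succ i ih =>
    rw [treeMean_succ, treeMean_congr fun G hG => step_rising3 hG, treeMean_const_mul, ih,
      growth_succ]
    ring

lemma treeMean_rising4 (i : ℕ) :
    treeMean i (rising4 i) = 36 * (i + 1) * (i + 2) - 24 * (i + 1) := by
  induction i with
  | zero =>
    rw [treeMean_zero, rising4, powSum_zero_tree two_ne_zero, powSum_zero_tree three_ne_zero,
      powSum_zero_tree four_ne_zero]
    norm_num
  | succ i ih =>
    rw [treeMean_succ, treeMean_congr fun G hG => step_rising4 hG, treeMean_add,
      treeMean_const_mul, treeMean_const, ih]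
    push_cast
    field_simp
    ring

lemma treeMean_mart_sq (i : ℕ) :
    ((i : ℝ) + 1) ^ 2 * treeMean i (fun G => mart i G ^ 2) =
      16 * ((i : ℝ) + 1) ^ 2 + 64 * (i + 1) - 96 * growth i + 20 * (i + 1) * harm 1 i
        + 4 * (i + 1) * harm 1 i ^ 2 - 4 * (i + 1) * harm 2 i - 4 * ((i : ℝ) + 1) ^ 2 * harm 2 i := by
  induction i with
  | zero =>
    rw [treeMean_zero, mart, powSum_zero_tree two_ne_zero]
    simp [growth, harm]
    norm_num
  | succ i ih =>
    rw [treeMean_succ, treeMean_congr fun G hG => step_mart_sq hG]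
    simp only [treeMean_add, treeMean_const_mul, treeMean_const]
    have e1 : treeMean i (fun G => mart i G) = 0 := treeMean_mart i
    have e2 : treeMean i (fun G => rising3 i G) = 24 * growth i := treeMean_rising3 i
    have hne : ((i : ℝ) + 1) ^ 2 ≠ 0 := by positivity
    -- The closed form is stated without denominators, so the induction hypothesis is first solved
    -- for the moment; what remains is a rational identity.
    rw [e1, e2, eq_div_of_mul_eq hne ((mul_comm _ _).trans ih), harm_succ, harm_succ, growth_succ]
    have := two_ne i
    push_cast
    field_simp
    ring

/-- In this scaling the homogeneous solution is `growth i * (2 * i + 5)`, and the `oddHarm` terms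
are 48 `oddHarm i` times it: they come from variation of constants. -/
lemma treeMean_mart_mul_rising3 (i : ℕ) :
    ((i : ℝ) + 1) * treeMean i (fun G => mart i G * rising3 i G) =
      growth i * (384 + 80 * (i + 1) - 48 * (i + 1) * harm 1 i + 144 * oddHarm i
        + 96 * (i + 1) * oddHarm i)
      - 256 * (i + 1) - 216 * ((i : ℝ) + 1) ^ 2 - 24 * (i + 1) * harm 1 i := by
  induction i with
  | zero =>
    rw [treeMean_zero, mart, powSum_zero_tree two_ne_zero]
    simp [growth, harm, oddHarm]
    norm_num
  | succ i ih =>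
    rw [treeMean_succ, treeMean_congr fun G hG => step_mart_mul_rising3 hG]
    simp only [treeMean_add, treeMean_const_mul, treeMean_const]
    have e1 : treeMean i (fun G => mart i G) = 0 := treeMean_mart i
    have e2 : treeMean i (fun G => rising3 i G) = 24 * growth i := treeMean_rising3 i
    have e3 := treeMean_rising4 i
    have e3' : treeMean i (fun G => rising4 i G) = treeMean i (rising4 i) := rfl
    have hne : ((i : ℝ) + 1) ≠ 0 := by positivity
    rw [e1, e2, e3', e3, eq_div_of_mul_eq hne ((mul_comm _ _).trans ih), harm_succ, oddHarm_succ,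
      growth_succ]
    have := two_ne i
    have : 2 * (i : ℝ) + 5 ≠ 0 := by positivity
    push_cast
    field_simp
    ring

/-- The coefficient of (i+1)^3 carries the limit. Every other term is of lower order, the largest
being `growth i * (i + 1)` times a harmonic sum. -/
lemma treeMean_mart_cube (i : ℕ) :
    ((i : ℝ) + 1) ^ 3 * treeMean i (fun G => mart i G ^ 3) =
      growth i * (-3648 - 960 * (i + 1) + 576 * (i + 1) * harm 1 i - 1728 * oddHarm i
        - 1152 * (i + 1) * oddHarm i)
      + (i + 1) * (2432 + 728 * harm 1 i + 144 * harm 1 i ^ 2 - 144 * harm 2 i + 32 * harm 3 i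
        + 16 * harm 1 i ^ 3 - 48 * harm 1 i * harm 2 i)
      + ((i : ℝ) + 1) ^ 2 * (1716 + 192 * harm 1 i - 120 * harm 2 i + 48 * harm 3 i
        - 48 * harm 1 i * harm 2 i)
      + ((i : ℝ) + 1) ^ 3 * (28 + 16 * harm 3 i) := by
  induction i with
  | zero =>
    rw [treeMean_zero, mart, powSum_zero_tree two_ne_zero]
    simp [growth, harm, oddHarm]
    norm_num
  | succ i ih =>
    rw [treeMean_succ, treeMean_congr fun G hG => step_mart_cube hG]
    simp only [treeMean_add, treeMean_const_mul, treeMean_const]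
    have e1 : treeMean i (fun G => mart i G) = 0 := treeMean_mart i
    have e2 : treeMean i (fun G => rising3 i G) = 24 * growth i := treeMean_rising3 i
    have e3 := treeMean_rising4 i
    have e3' : treeMean i (fun G => rising4 i G) = treeMean i (rising4 i) := rfl
    have hne : ((i : ℝ) + 1) ≠ 0 := by positivity
    have hne2 : ((i : ℝ) + 1) ^ 2 ≠ 0 := by positivity
    have hne3 : ((i : ℝ) + 1) ^ 3 ≠ 0 := by positivity
    rw [e1, e2, e3', e3, eq_div_of_mul_eq hne3 ((mul_comm _ _).trans ih),
      eq_div_of_mul_eq hne ((mul_comm _ _).trans (treeMean_mart_mul_rising3 i)),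
      eq_div_of_mul_eq hne2 ((mul_comm _ _).trans (treeMean_mart_sq i)),
      harm_succ, harm_succ, harm_succ, oddHarm_succ, growth_succ]
    have := two_ne i
    have : 2 * (i : ℝ) + 5 ≠ 0 := by positivity
    push_cast
    field_simp
    ring

/-! ### Bounds for the growth of moments -/

lemma growth_pos (i : ℕ) : 0 < growth i := Finset.prod_pos fun j _ => by positivity

lemma growth_sq_le (i : ℕ) : growth i ^ 2 ≤ ((i : ℝ) + 1) ^ 3 := by
  induction i with
  | zero => simp [growth]
  | succ i ih =>
    rw [growth_succ, mul_pow]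
    calc growth i ^ 2 * (1 + 3 / (2 * ((i : ℝ) + 1))) ^ 2
        ≤ ((i : ℝ) + 1) ^ 3 * (1 + 3 / (2 * ((i : ℝ) + 1))) ^ 2 := by gcongr
      _ = ((i : ℝ) + 1) * (i + 1 + 3 / 2) ^ 2 := by field_simp
      _ ≤ _ := by
        push_cast
        nlinarith [(Nat.cast_nonneg i : (0 : ℝ) ≤ i)]

lemma harm_nonneg (k i : ℕ) : 0 ≤ harm k i := Finset.sum_nonneg fun j _ => by positivity

lemma harm_one_le (i : ℕ) : harm 1 i ≤ 2 * √((i : ℝ) + 1) - 1 := by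
  induction i with
  | zero => simp [harm]; norm_num
  | succ i ih =>
    rw [harm_succ]
    push_cast
    have h0 : (0 : ℝ) ≤ (i : ℝ) + 1 := by positivity
    have h2 : (i : ℝ) + 1 + 1 = i + 2 := by ring
    rw [h2]
    set s := √((i : ℝ) + 1)
    set r := √((i : ℝ) + 2) with hr
    have hs2 : s ^ 2 = i + 1 := Real.sq_sqrt h0
    have hr2 : r ^ 2 = i + 2 := Real.sq_sqrt (by positivity)
    have hr1 : 1 ≤ r := Real.one_le_sqrt.2 (by linarith [(Nat.cast_nonneg i : (0 : ℝ) ≤ i)])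
    have hs0 : 0 ≤ s := Real.sqrt_nonneg _
    have hsr : s ≤ r := Real.sqrt_le_sqrt (by linarith)
    -- Rationalizing, r - s = 1/(r + s) ≥ 1/(2r) ≥ 1/(2r^2).
    have key : 1 / ((i : ℝ) + 2) ^ 1 ≤ 2 * (r - s) := by
      rw [pow_one, ← hr2, div_le_iff₀ (by positivity)]
      have : (r - s) * (r + s) = 1 := by nlinarith
      nlinarith [mul_nonneg (sub_nonneg.2 hsr) hs0,
        mul_nonneg (sub_nonneg.2 hsr) (sub_nonneg.2 hr1)]
    linarith

lemma treeMean_rising5_le (i : ℕ) : treeMean i (rising5 i) ≤ 240 * ((i : ℝ) + 1) ^ 3 := by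
  induction i with
  | zero =>
    rw [treeMean_zero, rising5, powSum_zero_tree two_ne_zero, powSum_zero_tree three_ne_zero,
      powSum_zero_tree four_ne_zero, powSum_zero_tree (by norm_num)]
    norm_num
  | succ i ih =>
    rw [treeMean_succ, treeMean_congr fun G hG => step_rising5 hG, treeMean_add,
      treeMean_const_mul, treeMean_const]
    calc (1 + 5 / (2 * ((i : ℝ) + 1))) * treeMean i (rising5 i) + 120
        ≤ (1 + 5 / (2 * ((i : ℝ) + 1))) * (240 * ((i : ℝ) + 1) ^ 3) + 120 := by gcongr
      _ = 240 * ((i : ℝ) + 1) ^ 3 + 600 * ((i : ℝ) + 1) ^ 2 + 120 := by field_simp; ring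
      _ ≤ _ := by
        push_cast
        nlinarith [(Nat.cast_nonneg i : (0 : ℝ) ≤ i), sq_nonneg (i : ℝ)]

/-- The squared conditional mean gives the first term. The leading part of the conditional variance
is 9 times the size-biased mean of deg^4, which `rising5` dominates. -/
lemma step_rising3_sq_le {i : ℕ} {G : SimpleGraph (Fin (i + 2))}
    (h1 : powSum G 1 = 2 * (i + 1)) :
    stepMean G (fun v => rising3 (i + 1) (attachLeaf G v) ^ 2) ≤
      (1 + 3 / (2 * (i + 1))) ^ 2 * rising3 i G ^ 2 + 9 / (2 * (i + 1)) * rising5 i G := by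
  set γ : ℝ := rising3 i G + 24 with hγ
  rw [stepMean_eq_of_quartic G h1 (γ ^ 2) (18 * γ) (81 + 6 * γ) 54 9
    (fun v => by rw [rising3_attachLeaf]; ring)]
  have h2 := powSum_nonneg G 2
  have h3 := powSum_nonneg G 3
  have h4 := powSum_nonneg G 4
  have key : (1 + 3 / (2 * ((i : ℝ) + 1))) ^ 2 * rising3 i G ^ 2 + 9 / (2 * (i + 1)) * rising5 i G
      - (γ ^ 2 + (18 * γ * powSum G 2 + (81 + 6 * γ) * powSum G 3 + 54 * powSum G 4
        + 9 * powSum G 5) / (2 * (i + 1))) =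
      ((9 * powSum G 2 + 3 * powSum G 3) / (2 * (i + 1))) ^ 2
        + (36 * powSum G 4 + 234 * powSum G 3 + 450 * powSum G 2) / (2 * (i + 1)) + 216 := by
    rw [hγ, rising3, rising5]
    field_simp
    ring
  have : 0 ≤ ((9 * powSum G 2 + 3 * powSum G 3) / (2 * ((i : ℝ) + 1))) ^ 2
        + (36 * powSum G 4 + 234 * powSum G 3 + 450 * powSum G 2) / (2 * (i + 1)) + 216 := by
    positivity
  linarith

lemma treeMean_rising3_sq_le (i : ℕ) :
    treeMean i (fun G => rising3 i G ^ 2) ≤ 1080 * ((i : ℝ) + 1) ^ 3 * (1 + harm 1 i) := by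
  induction i with
  | zero =>
    rw [treeMean_zero, rising3, powSum_zero_tree two_ne_zero, powSum_zero_tree three_ne_zero]
    simp [harm]
    norm_num
  | succ i ih =>
    rw [treeMean_succ]
    refine (treeMean_mono fun G hG => step_rising3_sq_le hG).trans ?_
    rw [treeMean_add, treeMean_const_mul, treeMean_const_mul]
    have h5 := treeMean_rising5_le i
    have hh := harm_nonneg 1 i
    calc (1 + 3 / (2 * ((i : ℝ) + 1))) ^ 2 * treeMean i (fun G => rising3 i G ^ 2)
          + 9 / (2 * ((i : ℝ) + 1)) * treeMean i (fun G => rising5 i G)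
        -- The constant 1080 is (9/2) · 240, so each step adds 1080(i+1)^2; this is the source of
        -- the harmonic factor.
        ≤ (1 + 3 / (2 * ((i : ℝ) + 1))) ^ 2 * (1080 * ((i : ℝ) + 1) ^ 3 * (1 + harm 1 i))
          + 9 / (2 * ((i : ℝ) + 1)) * (240 * ((i : ℝ) + 1) ^ 3) := by gcongr
      _ = 1080 * (((i : ℝ) + 1) * (i + 1 + 3 / 2) ^ 2 * (1 + harm 1 i) + ((i : ℝ) + 1) ^ 2) := by
        field_simp; ring
      _ ≤ 1080 * (((i : ℝ) + 2) ^ 3 * (1 + harm 1 i) + ((i : ℝ) + 2) ^ 2) := by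
        have : (0 : ℝ) ≤ i := Nat.cast_nonneg i
        gcongr ?_ * (?_ * _ + ?_ ^ 2)
        · nlinarith
        · linarith
      _ = _ := by
        rw [harm_succ]
        have := two_ne i
        push_cast
        field_simp
        ring

/-! ### The fourth moment is bounded -/

open scoped Classical in
lemma stepMean_mono {n : ℕ} {G : SimpleGraph (Fin (n + 2))} {F F' : Fin (n + 2) → ℝ}
    (h : ∀ v, F v ≤ F' v) : stepMean G F ≤ stepMean G F' :=
  Finset.sum_le_sum fun v _ => mul_le_mul_of_nonneg_left (h v) (by positivity)

open scoped Classical in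
lemma mart_attachLeaf_eq_add {i : ℕ} (G : SimpleGraph (Fin (i + 2))) (v : Fin (i + 2)) :
    mart (i + 1) (attachLeaf G v) =
      mart i G + (2 * G.degree v - powSum G 2 / (i + 1)) / (i + 2) := by
  have := two_ne i
  rw [mart_attachLeaf, mart, harm_succ]
  field_simp
  ring

/-- Nonnegativity of a size-biased variance: the left side is the squared mean of 2 deg, the right
side the mean of its square. -/
lemma mean_degree_sq_le {i : ℕ} {G : SimpleGraph (Fin (i + 2))}
    (h1 : powSum G 1 = 2 * (i + 1)) :
    (powSum G 2 / (i + 1)) ^ 2 ≤ 2 * powSum G 3 / (i + 1) := by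
  classical
  set b := powSum G 2 / ((i : ℝ) + 1)
  have h : stepMean G (fun v => (2 * (G.degree v : ℝ) - b) ^ 2) =
      2 * powSum G 3 / (i + 1) - b ^ 2 := by
    rw [stepMean_eq_of_quartic G h1 (b ^ 2) (-(4 * b)) 4 0 0 (fun v => by ring)]
    simp only [b]
    field_simp
    ring
  have h0 : stepMean G (fun _ => (0 : ℝ)) ≤ stepMean G fun v => (2 * (G.degree v : ℝ) - b) ^ 2 :=
    stepMean_mono fun v => by positivity
  rw [h] at h0
  simp only [stepMean, smul_zero, Finset.sum_const_zero] at h0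
  linarith

lemma mean_degree_fourth_le {i : ℕ} {G : SimpleGraph (Fin (i + 2))}
    (h1 : powSum G 1 = 2 * (i + 1)) :
    (powSum G 2 / (i + 1)) ^ 4 ≤ 8 * powSum G 5 / (i + 1) := by
  classical
  set c := 2 * powSum G 3 / ((i : ℝ) + 1)
  have h : stepMean G (fun v => (4 * (G.degree v : ℝ) ^ 2 - c) ^ 2) =
      8 * powSum G 5 / (i + 1) - c ^ 2 := by
    rw [stepMean_eq_of_quartic G h1 (c ^ 2) 0 (-(8 * c)) 0 16 (fun v => by ring)]
    simp only [c]
    field_simp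
    ring
  have h0 : stepMean G (fun _ => (0 : ℝ)) ≤
      stepMean G fun v => (4 * (G.degree v : ℝ) ^ 2 - c) ^ 2 :=
    stepMean_mono fun v => by positivity
  rw [h] at h0
  simp only [stepMean, smul_zero, Finset.sum_const_zero] at h0
  have h2 := mean_degree_sq_le h1
  calc (powSum G 2 / ((i : ℝ) + 1)) ^ 4 = ((powSum G 2 / ((i : ℝ) + 1)) ^ 2) ^ 2 := by ring
    _ ≤ c ^ 2 := by gcongr
    _ ≤ _ := by linarith

/-- Only 4xy^3 ≤ 2x^2y^2 + 2y^4 is used. The term linear in y is kept exact because it averages to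
zero for a martingale increment. -/
lemma add_pow_four_le (x y : ℝ) : (x + y) ^ 4 ≤
    x ^ 4 + 4 * x ^ 3 * y + 8 * x ^ 2 * y ^ 2 + 3 * y ^ 4 := by
  nlinarith [sq_nonneg (x * y - y ^ 2)]

lemma sub_pow_four_le {a b : ℝ} (ha : 0 ≤ a) (hb : 0 ≤ b) : (a - b) ^ 4 ≤ a ^ 4 + b ^ 4 := by
  have h : 0 ≤ a * b * (4 * (a - b) ^ 2 + 2 * (a * b)) := by positivity
  nlinarith [h]

lemma step_mart_fourth_le {i : ℕ} {G : SimpleGraph (Fin (i + 2))}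
    (h1 : powSum G 1 = 2 * (i + 1)) :
    stepMean G (fun v => mart (i + 1) (attachLeaf G v) ^ 4) ≤
      mart i G ^ 4 + 16 / ((i : ℝ) + 1) ^ 3 * (mart i G ^ 2 * rising3 i G)
        + 48 / ((i : ℝ) + 1) ^ 5 * rising5 i G := by
  classical
  set b := powSum G 2 / ((i : ℝ) + 1) with hb
  set x := mart i G
  have hb0 : 0 ≤ b := div_nonneg (powSum_nonneg G 2) (by positivity)
  have hpt : ∀ v, mart (i + 1) (attachLeaf G v) ^ 4 ≤
      x ^ 4 + 4 * x ^ 3 * ((2 * G.degree v - b) / (i + 2))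
        + 8 * x ^ 2 * ((2 * G.degree v - b) / (i + 2)) ^ 2
        + 3 * ((2 * (G.degree v : ℝ)) ^ 4 + b ^ 4) / (i + 2) ^ 4 := fun v => by
    rw [mart_attachLeaf_eq_add]
    refine (add_pow_four_le _ _).trans ?_
    have := sub_pow_four_le (a := 2 * (G.degree v : ℝ)) (by positivity) hb0
    rw [div_pow _ _ 4, mul_div_assoc 3]
    gcongr
  refine (stepMean_mono hpt).trans ?_
  set k : ℝ := (i : ℝ) + 2 with hk
  rw [stepMean_eq_of_quartic G h1
    (x ^ 4 - 4 * x ^ 3 * b / k + 8 * x ^ 2 * b ^ 2 / k ^ 2 + 3 * b ^ 4 / k ^ 4)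
    (8 * x ^ 3 / k - 32 * x ^ 2 * b / k ^ 2) (32 * x ^ 2 / k ^ 2) 0 (48 / k ^ 4)
    (fun v => by ring_nf)]
  have h4 := mean_degree_fourth_le h1
  have hk0 : 0 < k := by positivity
  have hm0 : (0 : ℝ) < (i : ℝ) + 1 := by positivity
  have hmk : (i : ℝ) + 1 ≤ k := by linarith
  have h2 := powSum_nonneg G 2
  have h3 := powSum_nonneg G 3
  have h4' := powSum_nonneg G 4
  have h5 := powSum_nonneg G 5
  have e : x ^ 4 - 4 * x ^ 3 * b / k + 8 * x ^ 2 * b ^ 2 / k ^ 2 + 3 * b ^ 4 / k ^ 4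
      + ((8 * x ^ 3 / k - 32 * x ^ 2 * b / k ^ 2) * powSum G 2 + 32 * x ^ 2 / k ^ 2 * powSum G 3
        + 0 * powSum G 4 + 48 / k ^ 4 * powSum G 5) / (2 * (i + 1)) =
      x ^ 4 + 16 * x ^ 2 * powSum G 3 / (k ^ 2 * (i + 1)) - 8 * x ^ 2 * b ^ 2 / k ^ 2
        + 3 / k ^ 4 * (8 * powSum G 5 / (i + 1) + b ^ 4) := by
    rw [hb]
    field_simp
    ring
  rw [e]
  have t1 : 16 * x ^ 2 * powSum G 3 / (k ^ 2 * (i + 1)) ≤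
      16 / ((i : ℝ) + 1) ^ 3 * (x ^ 2 * rising3 i G) := by
    have hQ : powSum G 3 ≤ rising3 i G := by unfold rising3; linarith
    calc _ ≤ 16 * x ^ 2 * rising3 i G / (((i : ℝ) + 1) ^ 2 * (i + 1)) := by
          have := h3.trans hQ
          gcongr
      _ = _ := by field_simp
  have t2 : 3 / k ^ 4 * (8 * powSum G 5 / (i + 1) + b ^ 4) ≤
      48 / ((i : ℝ) + 1) ^ 5 * rising5 i G := by
    have hR : powSum G 5 ≤ rising5 i G := by unfold rising5; linarith
    calc _ ≤ 3 / k ^ 4 * (8 * powSum G 5 / (i + 1) + 8 * powSum G 5 / (i + 1)) := by gcongr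
      _ ≤ 3 / ((i : ℝ) + 1) ^ 4 * (8 * rising5 i G / (i + 1) + 8 * rising5 i G / (i + 1)) := by
          have := h5.trans hR
          gcongr
      _ = _ := by field_simp; ring
  have t3 : 0 ≤ 8 * x ^ 2 * b ^ 2 / k ^ 2 := by positivity
  linarith

/-- With w = (i+1)^{1/4}, the cross term M^2 `rising3` is split by AM-GM with weight w^7. As
E[`rising3`^2] = O(w^14), every error is O(w^{-5}), which is summable. The constant 40000 has slack:
17280 + 11520 would do. -/
lemma treeMean_mart_fourth_succ_le (i : ℕ) :
    treeMean (i + 1) (fun G => mart (i + 1) G ^ 4) + 1 ≤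
      (treeMean i (fun G => mart i G ^ 4) + 1) * (1 + 40000 / ((i : ℝ) + 1) ^ (5 / 4 : ℝ)) := by
  set w : ℝ := ((i : ℝ) + 1) ^ (1 / 4 : ℝ) with hw
  have hi : (0 : ℝ) ≤ (i : ℝ) + 1 := by positivity
  have hw1 : 1 ≤ w := Real.one_le_rpow (by linarith [(Nat.cast_nonneg i : (0 : ℝ) ≤ i)])
    (by norm_num)
  have hw0 : 0 < w := by linarith
  have hw4 : (i : ℝ) + 1 = w ^ 4 := by
    rw [hw, ← Real.rpow_natCast, ← Real.rpow_mul hi]; norm_num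
  have hw5 : ((i : ℝ) + 1) ^ (5 / 4 : ℝ) = w ^ 5 := by
    rw [hw, ← Real.rpow_natCast, ← Real.rpow_mul hi]; norm_num
  have hharm : 1 + harm 1 i ≤ 2 * w ^ 2 := by
    have := harm_one_le i
    have hs : √((i : ℝ) + 1) = w ^ 2 := by
      rw [hw4, show w ^ 4 = (w ^ 2) ^ 2 by ring, Real.sqrt_sq (by positivity)]
    linarith
  have hQ := treeMean_rising3_sq_le i
  have hR := treeMean_rising5_le i
  have hp : 0 ≤ treeMean i (fun G => mart i G ^ 4) := treeMean_nonneg fun G => by positivity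
  rw [hw5]
  have step : treeMean (i + 1) (fun G => mart (i + 1) G ^ 4) ≤
      treeMean i (fun G => (1 + 8 / w ^ 5) * mart i G ^ 4 + 8 / w ^ 19 * rising3 i G ^ 2
        + 48 / w ^ 20 * rising5 i G) := by
    rw [treeMean_succ]
    refine treeMean_mono fun G hG => (step_mart_fourth_le hG).trans ?_
    rw [hw4]
    have h2 : 16 / (w ^ 4) ^ 3 * (mart i G ^ 2 * rising3 i G) ≤
        8 / w ^ 5 * mart i G ^ 4 + 8 / w ^ 19 * rising3 i G ^ 2 := by
      have : 8 / w ^ 5 * mart i G ^ 4 + 8 / w ^ 19 * rising3 i G ^ 2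
          - 16 / (w ^ 4) ^ 3 * (mart i G ^ 2 * rising3 i G) =
          8 / w ^ 19 * (w ^ 7 * mart i G ^ 2 - rising3 i G) ^ 2 := by
        field_simp
        ring
      have : 0 ≤ 8 / w ^ 19 * (w ^ 7 * mart i G ^ 2 - rising3 i G) ^ 2 := by positivity
      linarith
    have h3 : 48 / (w ^ 4) ^ 5 * rising5 i G = 48 / w ^ 20 * rising5 i G := by ring
    linarith
  rw [treeMean_add, treeMean_add, treeMean_const_mul, treeMean_const_mul, treeMean_const_mul]
    at step
  have hQ' : 8 / w ^ 19 * treeMean i (fun G => rising3 i G ^ 2) ≤ 17280 / w ^ 5 := by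
    calc _ ≤ 8 / w ^ 19 * (1080 * (w ^ 4) ^ 3 * (2 * w ^ 2)) := by
          rw [hw4] at hQ
          gcongr
          exact hQ.trans (by gcongr)
      _ = _ := by field_simp; norm_num
  have hR' : 48 / w ^ 20 * treeMean i (fun G => rising5 i G) ≤ 11520 / w ^ 5 := by
    calc _ ≤ 48 / w ^ 20 * (240 * (w ^ 4) ^ 3) := by
          rw [hw4] at hR
          gcongr
      _ = 11520 / w ^ 8 := by field_simp; norm_num
      _ ≤ _ := by
          gcongr
          norm_num
  have e : (treeMean i (fun G => mart i G ^ 4) + 1) * (1 + 40000 / w ^ 5) =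
    (1 + 8 / w ^ 5) * treeMean i (fun G => mart i G ^ 4) + 17280 / w ^ 5 + 11520 / w ^ 5 + 1
      + 39992 / w ^ 5 * treeMean i (fun G => mart i G ^ 4) + 11200 / w ^ 5 := by ring
  have : 0 ≤ 39992 / w ^ 5 * treeMean i (fun G => mart i G ^ 4) := by positivity
  have : 0 ≤ 11200 / w ^ 5 := by positivity
  linarith

lemma summable_succ_rpow {p : ℝ} (hp : 1 < p) :
    Summable fun i : ℕ => 1 / ((i : ℝ) + 1) ^ p := by
  have := (summable_nat_add_iff 1).2 (Real.summable_one_div_nat_rpow.2 hp)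
  simpa using this

/-- The multiplicative bounds iterate to ∏(1 + c_j) ≤ exp(∑ c_j) with ∑ c_j finite. -/
lemma exists_treeMean_mart_fourth_le :
    ∃ B : ℝ, ∀ i, treeMean i (fun G => mart i G ^ 4) ≤ B := by
  have hs : Summable fun i : ℕ => 40000 / ((i : ℝ) + 1) ^ (5 / 4 : ℝ) := by
    simpa [div_eq_mul_inv] using
      (summable_succ_rpow (p := 5 / 4) (by norm_num)).mul_left 40000
  set c : ℕ → ℝ := fun i => 40000 / ((i : ℝ) + 1) ^ (5 / 4 : ℝ)
  have hc : ∀ i, 0 ≤ c i := fun i => by positivity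
  have key : ∀ i, treeMean i (fun G => mart i G ^ 4) + 1 ≤
      (treeMean 0 (fun G => mart 0 G ^ 4) + 1) * Real.exp (∑ j ∈ Finset.range i, c j) := by
    intro i
    induction i with
    | zero => simp
    | succ i ih =>
      have hp : 0 ≤ treeMean i (fun G => mart i G ^ 4) := treeMean_nonneg fun G => by positivity
      rw [Finset.sum_range_succ, Real.exp_add, ← mul_assoc]
      refine (treeMean_mart_fourth_succ_le i).trans ?_
      refine mul_le_mul ih ?_ (by linarith [hc i]) (le_trans (by positivity) ih)
      rw [add_comm]
      exact Real.add_one_le_exp _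
  refine ⟨(treeMean 0 (fun G => mart 0 G ^ 4) + 1) * Real.exp (∑' j, c j), fun i => ?_⟩
  have h0 : 0 ≤ treeMean 0 (fun G => mart 0 G ^ 4) := treeMean_nonneg fun G => by positivity
  have := hs.sum_le_tsum (Finset.range i) (fun j _ => hc j)
  calc _ ≤ _ := (le_add_of_nonneg_right zero_le_one).trans (key i)
    _ ≤ _ := by gcongr

/-! ### The characteristic functions converge -/

lemma norm_exp_mul_I_sub_one_sub_le (y : ℝ) :
    ‖Complex.exp (y * Complex.I) - 1 - y * Complex.I‖ ≤ 2 * y ^ 2 := by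
  have hn : ‖(y : ℂ) * Complex.I‖ = |y| := by simp
  rcases le_total |y| 1 with h | h
  · refine (Complex.norm_exp_sub_one_sub_id_le (hn.trans_le h)).trans ?_
    rw [hn, sq_abs]
    nlinarith [sq_nonneg y]
  · have h1 : ‖Complex.exp (y * Complex.I) - 1‖ ≤ |y| := by
      have := Real.norm_exp_I_mul_ofReal_sub_one_le (x := y)
      rwa [mul_comm, Real.norm_eq_abs] at this
    refine (norm_sub_le _ _).trans ?_
    rw [hn, ← sq_abs]
    nlinarith

/-- The characteristic function of the normalized Zagreb index. -/
def martChar (i : ℕ) (t : ℝ) : ℂ :=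
  treeMean i fun G => Complex.exp ((t * mart i G : ℝ) * Complex.I)

open scoped Classical in
lemma norm_step_exp_sub_le {i : ℕ} {G : SimpleGraph (Fin (i + 2))}
    (h1 : powSum G 1 = 2 * (i + 1)) (t : ℝ) :
    ‖stepMean G (fun v => Complex.exp ((t * mart (i + 1) (attachLeaf G v) : ℝ) * Complex.I))
      - Complex.exp ((t * mart i G : ℝ) * Complex.I)‖ ≤
      4 * t ^ 2 / ((i : ℝ) + 1) ^ 3 * rising3 i G := by
  set b := powSum G 2 / ((i : ℝ) + 1) with hb
  set x := mart i G
  set ξ : Fin (i + 2) → ℝ := fun v => (2 * G.degree v - b) / (i + 2) with hξ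
  set w : Fin (i + 2) → ℝ := fun v => (G.degree v : ℝ) / (2 * (i + 1)) with hw
  have hw0 : ∀ v, 0 ≤ w v := fun v => by positivity
  have hs0 : ∑ v, w v = 1 := by
    have := stepMean_eq_of_quartic G h1 (F := fun _ => 1) 1 0 0 0 0 (fun v => by ring)
    simpa [stepMean] using this
  have hs1 : ∑ v, w v * ξ v = 0 := by
    have := stepMean_eq_of_quartic G h1 (F := ξ) (-b / (i + 2)) (2 / (i + 2)) 0 0 0
      (fun v => by simp only [hξ]; ring)
    simp only [stepMean, smul_eq_mul] at this
    rw [this, hb]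
    have := two_ne i
    field_simp
    ring
  have hs2 : ∑ v, w v * ξ v ^ 2 ≤ 2 / ((i : ℝ) + 1) ^ 3 * rising3 i G := by
    have := stepMean_eq_of_quartic G h1 (F := fun v => ξ v ^ 2) (b ^ 2 / (i + 2) ^ 2)
      (-(4 * b) / (i + 2) ^ 2) (4 / (i + 2) ^ 2) 0 0
      (fun v => by simp only [hξ, div_pow]; ring)
    simp only [stepMean, smul_eq_mul] at this
    rw [this]
    have h2 := powSum_nonneg G 2
    have h3 := powSum_nonneg G 3
    have hQ : powSum G 3 ≤ rising3 i G := by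
      unfold rising3
      have : (0 : ℝ) ≤ 16 * (i + 1) := by positivity
      linarith
    have e : b ^ 2 / ((i : ℝ) + 2) ^ 2 + (-(4 * b) / (i + 2) ^ 2 * powSum G 2
        + 4 / (i + 2) ^ 2 * powSum G 3 + 0 * powSum G 4 + 0 * powSum G 5) / (2 * (i + 1)) =
        2 * powSum G 3 / ((i + 2) ^ 2 * (i + 1)) - b ^ 2 / (i + 2) ^ 2 := by
      rw [hb]
      have := two_ne i
      field_simp
      ring
    rw [e]
    have : 0 ≤ b ^ 2 / ((i : ℝ) + 2) ^ 2 := by positivity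
    have : 2 * powSum G 3 / (((i : ℝ) + 2) ^ 2 * (i + 1)) ≤
        2 * rising3 i G / (((i : ℝ) + 1) ^ 2 * (i + 1)) := by
      have := h3.trans hQ
      gcongr
      linarith
    have : 2 * rising3 i G / (((i : ℝ) + 1) ^ 2 * (i + 1)) =
      2 / ((i : ℝ) + 1) ^ 3 * rising3 i G := by field_simp
    linarith
  -- The linear Taylor term is inserted for free, since the increments have weighted mean zero; only
  -- a second-order remainder is left.
  have hsum : stepMean G (fun v =>
        Complex.exp ((t * mart (i + 1) (attachLeaf G v) : ℝ) * Complex.I))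
      - Complex.exp ((t * x : ℝ) * Complex.I) =
      ∑ v, (w v : ℂ) * (Complex.exp ((t * x : ℝ) * Complex.I) *
        (Complex.exp ((t * ξ v : ℝ) * Complex.I) - 1 - (t * ξ v : ℝ) * Complex.I)) := by
    have hs0' : ∑ v, (w v : ℂ) = 1 := by exact_mod_cast hs0
    have hs1' : ∑ v, (w v : ℂ) * (ξ v : ℂ) = 0 := by exact_mod_cast hs1
    have e : ∀ v, (w v : ℂ) * (Complex.exp ((t * x : ℝ) * Complex.I) *
        (Complex.exp ((t * ξ v : ℝ) * Complex.I) - 1 - (t * ξ v : ℝ) * Complex.I)) =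
        w v • Complex.exp ((t * mart (i + 1) (attachLeaf G v) : ℝ) * Complex.I)
        - (w v : ℂ) * Complex.exp ((t * x : ℝ) * Complex.I)
        - (w v : ℂ) * (ξ v : ℂ) * (Complex.exp ((t * x : ℝ) * Complex.I) * t * Complex.I) := by
      intro v
      rw [mart_attachLeaf_eq_add, Complex.real_smul]
      have : Complex.exp ((t * (mart i G + (2 * G.degree v - powSum G 2 / (i + 1)) / (i + 2)) : ℝ)
          * Complex.I) = Complex.exp ((t * x : ℝ) * Complex.I) *
          Complex.exp ((t * ξ v : ℝ) * Complex.I) := by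
        rw [← Complex.exp_add]
        congr 1
        simp only [hξ, hb, x]
        push_cast
        ring
      rw [this]
      push_cast
      ring
    simp only [e, Finset.sum_sub_distrib, ← Finset.sum_mul, hs0', hs1', zero_mul, sub_zero, one_mul]
    rfl
  rw [hsum]
  calc _ ≤ ∑ v, w v * (2 * (t * ξ v) ^ 2) := by
        refine (norm_sum_le _ _).trans (Finset.sum_le_sum fun v _ => ?_)
        rw [norm_mul, norm_mul, Complex.norm_exp_ofReal_mul_I, one_mul, Complex.norm_real,
          Real.norm_of_nonneg (hw0 v)]
        exact mul_le_mul_of_nonneg_left (norm_exp_mul_I_sub_one_sub_le _) (hw0 v)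
    _ = 2 * t ^ 2 * ∑ v, w v * ξ v ^ 2 := by
        rw [Finset.mul_sum]
        exact Finset.sum_congr rfl fun v _ => by ring
    _ ≤ 2 * t ^ 2 * (2 / ((i : ℝ) + 1) ^ 3 * rising3 i G) := by gcongr
    _ = _ := by ring

lemma growth_le_rpow (i : ℕ) : growth i ≤ ((i : ℝ) + 1) ^ (3 / 2 : ℝ) := by
  have hi : (0 : ℝ) ≤ (i : ℝ) + 1 := by positivity
  refine le_of_sq_le_sq ?_ (by positivity)
  rw [← Real.rpow_natCast (_ ^ (3 / 2 : ℝ)), ← Real.rpow_mul hi]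
  refine (growth_sq_le i).trans_eq ?_
  rw [← Real.rpow_natCast]
  norm_num

lemma dist_martChar_succ_le (i : ℕ) (t : ℝ) :
    dist (martChar i t) (martChar (i + 1) t) ≤ 96 * t ^ 2 * (1 / ((i : ℝ) + 1) ^ (3 / 2 : ℝ)) := by
  rw [dist_comm, dist_eq_norm, martChar, martChar, treeMean_succ, treeMean, treeMean, ← pmfMean_sub]
  refine (norm_pmfMean_le _ _).trans ?_
  refine (pmfMean_mono fun G hG => norm_step_exp_sub_le (powSum_one_of_mem hG) t).trans ?_
  rw [pmfMean_const_mul, ← treeMean]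
  have h : treeMean i (fun G => rising3 i G) = 24 * growth i := treeMean_rising3 i
  rw [h]
  have hi : (0 : ℝ) < (i : ℝ) + 1 := by positivity
  have h3 : ((i : ℝ) + 1) ^ 3 = ((i : ℝ) + 1) ^ (3 / 2 : ℝ) * ((i : ℝ) + 1) ^ (3 / 2 : ℝ) := by
    rw [← Real.rpow_add hi, ← Real.rpow_natCast]
    norm_num
  calc 4 * t ^ 2 / ((i : ℝ) + 1) ^ 3 * (24 * growth i)
      ≤ 4 * t ^ 2 / ((i : ℝ) + 1) ^ 3 * (24 * ((i : ℝ) + 1) ^ (3 / 2 : ℝ)) := by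
        gcongr
        exact growth_le_rpow i
    _ = _ := by
        rw [h3]
        field_simp
        ring

lemma exists_tendsto_martChar (t : ℝ) : ∃ z, Tendsto (fun i => martChar i t) atTop (𝓝 z) :=
  cauchySeq_tendsto_of_complete <| cauchySeq_of_dist_le_of_summable _
    (fun i => dist_martChar_succ_le i t) ((summable_succ_rpow (by norm_num)).mul_left _)

/-! ### Weak convergence and moments -/

section Weak

variable {P : ℕ → ProbabilityMeasure ℝ} {B : ℝ}

lemma isTightMeasureSet_of_fourth_moment_le
    (hi : ∀ n, Integrable (fun x : ℝ => x ^ 4) (P n : Measure ℝ))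
    (hB : ∀ n, ∫ x, x ^ 4 ∂(P n : Measure ℝ) ≤ B) :
    IsTightMeasureSet {((μ : ProbabilityMeasure ℝ) : Measure ℝ) | μ ∈ Set.range P} := by
  refine isTightMeasureSet_of_tendsto_measure_norm_gt ?_
  have hlim : Tendsto (fun r : ℝ => ENNReal.ofReal (B / r ^ 4)) atTop (𝓝 0) := by
    rw [← ENNReal.ofReal_zero]
    exact ENNReal.tendsto_ofReal
      (tendsto_const_nhds.div_atTop (tendsto_pow_atTop (by norm_num)))
  refine tendsto_of_tendsto_of_tendsto_of_le_of_le' tendsto_const_nhds hlim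
    (Eventually.of_forall fun _ => zero_le) ?_
  filter_upwards [eventually_gt_atTop 0] with r hr
  refine iSup₂_le fun μ hμ => ?_
  obtain ⟨_, ⟨n, rfl⟩, rfl⟩ := hμ
  have hr4 : 0 < r ^ 4 := by positivity
  have hsub : {x : ℝ | r < ‖x‖} ⊆ {x | r ^ 4 ≤ x ^ 4} := fun x hx => by
    have hx' : r < |x| := hx
    have : r ^ 4 ≤ |x| ^ 4 := by gcongr
    rwa [Even.pow_abs (by decide)] at this
  have hm := mul_meas_ge_le_integral_of_nonneg (μ := (P n : Measure ℝ))
    (Eventually.of_forall fun x : ℝ => (by positivity : 0 ≤ x ^ 4)) (hi n) (r ^ 4)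
  refine (measure_mono hsub).trans ?_
  rw [← ENNReal.ofReal_toReal (measure_ne_top (P n : Measure ℝ) {x : ℝ | r ^ 4 ≤ x ^ 4})]
  refine ENNReal.ofReal_le_ofReal ?_
  rw [le_div_iff₀' hr4]
  exact hm.trans (hB n)

/-- Tightness gives a limit along a nonprincipal ultrafilter. Its characteristic function must be
the assumed pointwise limit, so the whole sequence converges to it. -/
lemma exists_tendsto_of_tendsto_charFun
    (hi : ∀ n, Integrable (fun x : ℝ => x ^ 4) (P n : Measure ℝ))
    (hB : ∀ n, ∫ x, x ^ 4 ∂(P n : Measure ℝ) ≤ B)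
    (hc : ∀ t, ∃ z, Tendsto (fun n => charFun (P n : Measure ℝ) t) atTop (𝓝 z)) :
    ∃ μ, Tendsto P atTop (𝓝 μ) := by
  have hK := isCompact_closure_of_isTightMeasureSet (isTightMeasureSet_of_fourth_moment_le hi hB)
  obtain ⟨μ, -, hμ⟩ := hK.ultrafilter_le_nhds ((hyperfilter ℕ).map P) (by
    rw [Ultrafilter.coe_map, le_principal_iff]
    exact mem_map.2 (Eventually.of_forall fun n => subset_closure ⟨n, rfl⟩))
  have hμ' : Tendsto P (hyperfilter ℕ : Filter ℕ) (𝓝 μ) := hμ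
  refine ⟨μ, ProbabilityMeasure.tendsto_iff_tendsto_charFun.2 fun t => ?_⟩
  obtain ⟨z, hz⟩ := hc t
  have h1 : Tendsto (fun n => charFun (P n : Measure ℝ) t) (hyperfilter ℕ : Filter ℕ)
      (𝓝 (charFun (μ : Measure ℝ) t)) := by
    rw [ProbabilityMeasure.tendsto_iff_forall_integral_rclike_tendsto ℂ] at hμ'
    simp_rw [charFun_eq_integral_innerProbChar]
    exact hμ' (BoundedContinuousFunction.innerProbChar t)
  rwa [tendsto_nhds_unique h1 (hz.mono_left Nat.hyperfilter_le_atTop)]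

variable {μ : ProbabilityMeasure ℝ}

/-- Fatou for weak convergence, through the portmanteau bound on open sets. -/
lemma lintegral_fourth_le_of_tendsto
    (hi : ∀ n, Integrable (fun x : ℝ => x ^ 4) (P n : Measure ℝ))
    (hB : ∀ n, ∫ x, x ^ 4 ∂(P n : Measure ℝ) ≤ B) (h : Tendsto P atTop (𝓝 μ)) :
    ∫⁻ x, ENNReal.ofReal (x ^ 4) ∂(μ : Measure ℝ) ≤ ENNReal.ofReal B := by
  refine (lintegral_le_liminf_lintegral_of_forall_isOpen_measure_le_liminf_measure
    (μs := fun n => (P n : Measure ℝ)) (f := fun x : ℝ => x ^ 4) (by fun_prop)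
    (fun x => by positivity)
    (fun U hU => ProbabilityMeasure.le_liminf_measure_open_of_tendsto h hU)).trans ?_
  refine liminf_le_of_frequently_le' (Frequently.of_forall fun n => ?_)
  rw [← ofReal_integral_eq_lintegral_ofReal (hi n) (Eventually.of_forall fun x => by positivity)]
  exact ENNReal.ofReal_le_ofReal (hB n)

lemma integrable_fourth_of_tendsto
    (hi : ∀ n, Integrable (fun x : ℝ => x ^ 4) (P n : Measure ℝ))
    (hB : ∀ n, ∫ x, x ^ 4 ∂(P n : Measure ℝ) ≤ B) (h : Tendsto P atTop (𝓝 μ)) :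
    Integrable (fun x : ℝ => x ^ 4) (μ : Measure ℝ) := by
  refine ⟨by fun_prop, ?_⟩
  rw [hasFiniteIntegral_iff_ofReal (Eventually.of_forall fun x => by positivity)]
  exact (lintegral_fourth_le_of_tendsto hi hB h).trans_lt ENNReal.ofReal_lt_top

lemma integral_fourth_le_of_tendsto
    (hi : ∀ n, Integrable (fun x : ℝ => x ^ 4) (P n : Measure ℝ))
    (hB : ∀ n, ∫ x, x ^ 4 ∂(P n : Measure ℝ) ≤ B) (h : Tendsto P atTop (𝓝 μ)) :
    ∫ x, x ^ 4 ∂(μ : Measure ℝ) ≤ B := by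
  have hB0 : 0 ≤ B := (integral_nonneg fun x => by positivity).trans (hB 0)
  rw [← ENNReal.ofReal_le_ofReal_iff hB0, ofReal_integral_eq_lintegral_ofReal
    (integrable_fourth_of_tendsto hi hB h) (Eventually.of_forall fun x => by positivity)]
  exact lintegral_fourth_le_of_tendsto hi hB h

lemma integrable_pow_of_fourth {m : Measure ℝ} [IsFiniteMeasure m] {k : ℕ} (hk : k ≤ 4)
    (h : Integrable (fun x : ℝ => x ^ 4) m) : Integrable (fun x : ℝ => x ^ k) m := by
  refine ((integrable_const (1 : ℝ)).add h).mono' (by fun_prop) (Eventually.of_forall fun x => ?_)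
  simp only [Pi.add_apply, norm_pow, Real.norm_eq_abs]
  have h4 : x ^ 4 = |x| ^ 4 := (Even.pow_abs (by decide) x).symm
  rw [h4]
  rcases le_total |x| 1 with hx | hx
  · have := pow_le_one₀ (n := k) (abs_nonneg x) hx
    have : 0 ≤ |x| ^ 4 := by positivity
    linarith
  · have := pow_le_pow_right₀ hx hk
    linarith

/-- Truncation of the real line to `[-K, K]`. -/
def clip (K x : ℝ) : ℝ := max (-K) (min x K)

lemma abs_clip_le {K : ℝ} (hK : 0 ≤ K) (x : ℝ) : |clip K x| ≤ K := by
  rw [abs_le, clip]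
  exact ⟨le_max_left _ _, max_le (by linarith) (min_le_right _ _)⟩

lemma abs_pow_sub_clip_pow_le {K : ℝ} (hK : 1 ≤ K) {k : ℕ} (hk : k ≤ 3) (x : ℝ) :
    |x ^ k - clip K x ^ k| ≤ 2 / K * x ^ 4 := by
  have hK0 : 0 < K := by linarith
  rcases le_or_gt |x| K with hx | hx
  · obtain ⟨h1, h2⟩ := abs_le.1 hx
    rw [clip, min_eq_left h2, max_eq_right h1, sub_self, abs_zero]
    positivity
  · have hc : |clip K x| ^ k ≤ |x| ^ k  :=
      pow_le_pow_left₀ (abs_nonneg _) ((abs_clip_le hK0.le x).trans hx.le) k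
    have h4 : x ^ 4 = |x| ^ 4 := (Even.pow_abs (by decide) x).symm
    have h3 : |x| ^ k ≤ |x| ^ 3 := pow_le_pow_right₀ (hK.trans hx.le) hk
    have h5 : |x| ^ 3 ≤ |x| ^ 4 / K := by
      rw [le_div_iff₀ hK0]
      calc |x| ^ 3 * K ≤ |x| ^ 3 * |x| := by gcongr
        _ = _ := by ring
    calc |x ^ k - clip K x ^ k| ≤ |x| ^ k + |clip K x| ^ k := by
          rw [← abs_pow, ← abs_pow]
          exact abs_sub _ _
      _ ≤ |x| ^ 4 / K + |x| ^ 4 / K := by linarith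
      _ = _ := by rw [h4]; ring

/-- The truncated power as a bounded continuous function. -/
def clipPow (K : ℝ) (hK : 0 ≤ K) (k : ℕ) : BoundedContinuousFunction ℝ ℝ :=
  BoundedContinuousFunction.ofNormedAddCommGroup (fun x => clip K x ^ k)
    (by unfold clip; fun_prop) (K ^ k) fun x => by
      rw [norm_pow, Real.norm_eq_abs]
      gcongr
      exact abs_clip_le hK x

lemma abs_integral_pow_sub_clip_le {m : Measure ℝ} [IsProbabilityMeasure m] {K : ℝ} (hK : 1 ≤ K)
    {k : ℕ} (hk : k ≤ 3) (h : Integrable (fun x : ℝ => x ^ 4) m) (hB : ∫ x, x ^ 4 ∂m ≤ B) :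
    |∫ x, x ^ k ∂m - ∫ x, clipPow K (zero_le_one.trans hK) k x ∂m| ≤ 2 / K * B := by
  rw [← integral_sub (integrable_pow_of_fourth (by lia) h) ((clipPow K _ k).integrable m)]
  refine (abs_integral_le_integral_abs).trans ?_
  calc _ ≤ ∫ x, 2 / K * x ^ 4 ∂m := integral_mono_of_nonneg
        (Eventually.of_forall fun x => abs_nonneg _) (h.const_mul _)
        (Eventually.of_forall fun x => abs_pow_sub_clip_pow_le hK hk x)
    _ ≤ _ := by
      rw [integral_const_mul]
      gcongr

lemma tendsto_integral_pow
    (hi : ∀ n, Integrable (fun x : ℝ => x ^ 4) (P n : Measure ℝ))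
    (hB : ∀ n, ∫ x, x ^ 4 ∂(P n : Measure ℝ) ≤ B) (h : Tendsto P atTop (𝓝 μ))
    {k : ℕ} (hk : k ≤ 3) :
    Tendsto (fun n => ∫ x, x ^ k ∂(P n : Measure ℝ)) atTop (𝓝 (∫ x, x ^ k ∂(μ : Measure ℝ))) := by
  rw [Metric.tendsto_atTop]
  intro ε hε
  have hB0 : 0 ≤ B := (integral_nonneg fun x => by positivity).trans (hB 0)
  -- The truncation error 2B/K is then below ε/3, uniformly in n and for the limit.
  set K : ℝ := 1 + 8 * B / ε
  have hK : 1 ≤ K := by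
    have : 0 ≤ 8 * B / ε := by positivity
    linarith
  have hKB : 2 / K * B < ε / 3 := by
    rw [div_mul_eq_mul_div, div_lt_iff₀ (by linarith)]
    have : ε / 3 * K = ε / 3 + 8 * B / 3 := by simp only [K]; field_simp
    linarith
  have hw := ProbabilityMeasure.tendsto_iff_forall_integral_tendsto.1 h
    (clipPow K (zero_le_one.trans hK) k)
  obtain ⟨N, hN⟩ := Metric.tendsto_atTop.1 hw (ε / 3) (by positivity)
  refine ⟨N, fun n hn => ?_⟩
  have h1 := abs_integral_pow_sub_clip_le hK hk (hi n) (hB n)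
  have h2 := abs_integral_pow_sub_clip_le hK hk (integrable_fourth_of_tendsto hi hB h)
    (integral_fourth_le_of_tendsto hi hB h)
  have h3 := hN n hn
  rw [Real.dist_eq] at h3 ⊢
  rw [abs_lt] at h3 ⊢
  rw [abs_le] at h1 h2
  constructor <;> linarith [h1.1, h1.2, h2.1, h2.2, h3.1, h3.2]

lemma memLp_three_of_fourth {m : Measure ℝ} [IsProbabilityMeasure m]
    (h : Integrable (fun x : ℝ => x ^ 4) m) : MemLp id 3 m := by
  have h4 : MemLp (id : ℝ → ℝ) 4 m := by
    rw [← integrable_norm_rpow_iff (by fun_prop) (by norm_num) (by norm_num)]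
    refine h.congr (Eventually.of_forall fun x => ?_)
    have : ((4 : ℝ≥0∞).toReal) = ((4 : ℕ) : ℝ) := by norm_num
    simp only [id, this, Real.rpow_natCast, Real.norm_eq_abs]
    exact (Even.pow_abs (by decide) x).symm
  exact h4.mono_exponent (by norm_num)

end Weak

/-- Reflection about the mean preserves the law and changes the sign of the cube. The case `v = 0`
is included, division by zero being zero. -/
lemma skewness_gaussianReal (m : ℝ) (v : NNReal) : skewness (gaussianReal m v) = 0 := by
  have hsym : (gaussianReal m v).map (fun x => 2 * m - x) = gaussianReal m v := by
    rw [gaussianReal_map_const_sub]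
    congr 1
    ring
  have h : skewness (gaussianReal m v) = -skewness (gaussianReal m v) := by
    conv_lhs => rw [skewness, ← hsym]
    rw [integral_map (by fun_prop) (by
      rw [hsym]
      exact ((measurable_standardize _).pow_const 3).aestronglyMeasurable), hsym, skewness,
      ← integral_neg]
    refine integral_congr_ae (Eventually.of_forall fun x => ?_)
    simp only [standardize, integral_id_gaussianReal]
    ring
  linarith

/-! ### Limits of the exact moments -/

lemma summable_inv_succ_cube : Summable fun k : ℕ => 1 / ((k : ℝ) + 1) ^ 3 := by
  have := summable_succ_rpow (p := 3) (by norm_num)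
  exact_mod_cast this

lemma tendsto_harm_two : Tendsto (harm 2) atTop (𝓝 (Real.pi ^ 2 / 6)) := by
  have h := hasSum_zeta_two.tendsto_sum_nat
  have h2 := (tendsto_add_atTop_iff_nat 2).2 h
  refine h2.congr fun i => ?_
  rw [Finset.sum_range_succ', harm]
  simp

lemma tendsto_harm_three : Tendsto (harm 3) atTop (𝓝 zetaThree) :=
  (tendsto_add_atTop_iff_nat 1).2 summable_inv_succ_cube.hasSum.tendsto_sum_nat

lemma tendsto_inv_sqrt_succ : Tendsto (fun i : ℕ => (√((i : ℝ) + 1))⁻¹) atTop (𝓝 0) :=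
  (Real.tendsto_sqrt_atTop.comp
    (tendsto_atTop_add_const_right _ 1 tendsto_natCast_atTop_atTop)).inv_tendsto_atTop

lemma harm_one_le_log (i : ℕ) : harm 1 i ≤ 1 + Real.log ((i : ℝ) + 1) := by
  have h := harmonic_le_one_add_log (i + 1)
  have e : ((harmonic (i + 1) : ℚ) : ℝ) = harm 1 i := by
    simp [harmonic, harm]
  rw [e] at h
  exact_mod_cast h

lemma tendsto_harm_one_div_sqrt :
    Tendsto (fun i : ℕ => harm 1 i * (√((i : ℝ) + 1))⁻¹) atTop (𝓝 0) := by
  have hlog : Tendsto (fun x : ℝ => Real.log x / √x) atTop (𝓝 0) := by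
    simp only [Real.sqrt_eq_rpow]
    exact (isLittleO_log_rpow_atTop (by norm_num : (0 : ℝ) < 1 / 2)).tendsto_div_nhds_zero
  have h1 : Tendsto (fun i : ℕ => Real.log ((i : ℝ) + 1) / √((i : ℝ) + 1)) atTop (𝓝 0) :=
    hlog.comp (tendsto_atTop_add_const_right _ 1 tendsto_natCast_atTop_atTop)
  have h2 := tendsto_inv_sqrt_succ.add h1
  rw [add_zero] at h2
  refine squeeze_zero (fun i => mul_nonneg (harm_nonneg 1 i) (by positivity)) (fun i => ?_) h2
  calc _ ≤ (1 + Real.log ((i : ℝ) + 1)) * (√((i : ℝ) + 1))⁻¹ := by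
        gcongr
        exact harm_one_le_log i
    _ = _ := by ring

lemma oddHarm_nonneg (i : ℕ) : 0 ≤ oddHarm i := Finset.sum_nonneg fun j _ => by positivity

lemma oddHarm_le (i : ℕ) : oddHarm i ≤ harm 1 i :=
  Finset.sum_le_sum fun j _ => one_div_le_one_div_of_le (by positivity)
    (by rw [pow_one]; linarith [(Nat.cast_nonneg j : (0 : ℝ) ≤ j)])

lemma growth_le_sqrt_cube (i : ℕ) : growth i ≤ √((i : ℝ) + 1) ^ 3 := by
  refine le_of_sq_le_sq ((growth_sq_le i).trans_eq ?_) (by positivity)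
  rw [← pow_mul, mul_comm 3 2, pow_mul, Real.sq_sqrt (by positivity)]

/-- The growth factor divided by its order of magnitude. -/
def relGrowth (i : ℕ) : ℝ := growth i * (√((i : ℝ) + 1))⁻¹ ^ 3

lemma tendsto_relGrowth_mul {u : ℕ → ℝ} (hu : Tendsto u atTop (𝓝 0)) :
    Tendsto (fun i => relGrowth i * u i) atTop (𝓝 0) := by
  refine bdd_le_mul_tendsto_zero' 1 (Eventually.of_forall fun i => ?_) hu
  have hs : 0 < √((i : ℝ) + 1) := Real.sqrt_pos.2 (by positivity)
  rw [relGrowth, abs_of_nonneg (mul_nonneg (growth_pos i).le (by positivity)), inv_pow,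
    ← div_eq_mul_inv, div_le_one (by positivity)]
  exact growth_le_sqrt_cube i

lemma tendsto_oddHarm_div_sqrt :
    Tendsto (fun i : ℕ => oddHarm i * (√((i : ℝ) + 1))⁻¹) atTop (𝓝 0) :=
  squeeze_zero (fun i => mul_nonneg (oddHarm_nonneg i) (by positivity))
    (fun i => by gcongr; exact oddHarm_le i) tendsto_harm_one_div_sqrt

/-- The variance of the normalized Zagreb index. -/
def martVar (i : ℕ) : ℝ := treeMean i fun G => mart i G ^ 2

/-- The third moment of the normalized Zagreb index. -/
def martThird (i : ℕ) : ℝ := treeMean i fun G => mart i G ^ 3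

lemma tendsto_martVar : Tendsto martVar atTop (𝓝 (16 - 2 * Real.pi ^ 2 / 3)) := by
  have he := tendsto_inv_sqrt_succ
  have hL := tendsto_harm_one_div_sqrt
  have hge := tendsto_relGrowth_mul he
  -- With s = √(i+1), the coordinates are 1/s, H/s, `relGrowth`/s and `harm 2`; all but the last
  -- tend to zero.
  have hF : Continuous fun p : ℝ × ℝ × ℝ × ℝ => 16 - 4 * p.2.2.2 + 64 * p.1 ^ 2 - 96 * p.2.2.1
      + 20 * (p.2.1 * p.1) + 4 * p.2.1 ^ 2 - 4 * p.2.2.2 * p.1 ^ 2 := by fun_prop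
  have h := (hF.tendsto (0, 0, 0, Real.pi ^ 2 / 6)).comp
    (he.prodMk_nhds (hL.prodMk_nhds (hge.prodMk_nhds tendsto_harm_two)))
  convert! h using 1
  · funext i
    have hs : 0 < √((i : ℝ) + 1) := Real.sqrt_pos.2 (by positivity)
    have hm : (i : ℝ) + 1 = √((i : ℝ) + 1) ^ 2 := (Real.sq_sqrt (by positivity)).symm
    have hV := treeMean_mart_sq i
    rw [← martVar] at hV
    simp only [Function.comp_apply, relGrowth]
    generalize √((i : ℝ) + 1) = s at *
    rw [hm] at hV
    rw [eq_div_of_mul_eq (by positivity) ((mul_comm _ _).trans hV)]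
    field_simp
    ring
  · congr 1
    ring

lemma tendsto_martThird : Tendsto martThird atTop (𝓝 (28 + 16 * zetaThree)) := by
  have he := tendsto_inv_sqrt_succ
  have hL := tendsto_harm_one_div_sqrt
  have hO := tendsto_oddHarm_div_sqrt
  have hge := tendsto_relGrowth_mul he
  have hgL := tendsto_relGrowth_mul hL
  have hgO := tendsto_relGrowth_mul hO
  have hF : Continuous fun p : ℝ × ℝ × ℝ × ℝ × ℝ × ℝ × ℝ =>
      (-3648 * p.2.2.1 * p.1 ^ 2 - 960 * p.2.2.1 + 576 * p.2.2.2.1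
        - 1728 * p.2.2.2.2.1 * p.1 ^ 2 - 1152 * p.2.2.2.2.1)
      + (2432 * p.1 ^ 4 + 728 * p.2.1 * p.1 ^ 3 + 144 * p.2.1 ^ 2 * p.1 ^ 2
        - 144 * p.2.2.2.2.2.1 * p.1 ^ 4 + 32 * p.2.2.2.2.2.2 * p.1 ^ 4
        + 16 * p.2.1 ^ 3 * p.1 - 48 * p.2.1 * p.2.2.2.2.2.1 * p.1 ^ 3)
      + (1716 * p.1 ^ 2 + 192 * p.2.1 * p.1 - 120 * p.2.2.2.2.2.1 * p.1 ^ 2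
        + 48 * p.2.2.2.2.2.2 * p.1 ^ 2 - 48 * p.2.1 * p.2.2.2.2.2.1 * p.1)
      + (28 + 16 * p.2.2.2.2.2.2) := by fun_prop
  have h := (hF.tendsto (0, 0, 0, 0, 0, Real.pi ^ 2 / 6, zetaThree)).comp
    (he.prodMk_nhds (hL.prodMk_nhds (hge.prodMk_nhds (hgL.prodMk_nhds (hgO.prodMk_nhds
      (tendsto_harm_two.prodMk_nhds tendsto_harm_three))))))
  convert! h using 1
  · funext i
    have hs : 0 < √((i : ℝ) + 1) := Real.sqrt_pos.2 (by positivity)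
    have hm : (i : ℝ) + 1 = √((i : ℝ) + 1) ^ 2 := (Real.sq_sqrt (by positivity)).symm
    have hU := treeMean_mart_cube i
    rw [← martThird] at hU
    simp only [Function.comp_apply, relGrowth]
    generalize √((i : ℝ) + 1) = s at *
    rw [hm] at hU
    rw [eq_div_of_mul_eq (by positivity) ((mul_comm _ _).trans hU)]
    field_simp
  · congr 1
    ring

/-! ### Numerical bounds -/

lemma zetaThree_gt : 1.2015 < zetaThree := by
  refine lt_of_lt_of_le ?_ (summable_inv_succ_cube.sum_le_tsum (Finset.range 32)
    fun k _ => by positivity)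
  norm_num [Finset.sum_range_succ]

/-- The tail is compared with the telescoping series of 1/((k-1)k(k+1)) ≥ 1/k^3. -/
lemma sum_inv_cube_le (n : ℕ) : ∑ k ∈ Finset.range (n + 10), 1 / ((k : ℝ) + 1) ^ 3 ≤
    1.2022 - 1 / (2 * ((n : ℝ) + 10) * (n + 11)) := by
  induction n with
  | zero => norm_num [Finset.sum_range_succ]
  | succ n ih =>
    rw [show n + 1 + 10 = n + 10 + 1 by ring, Finset.sum_range_succ]
    push_cast
    have hn : (0 : ℝ) ≤ n := Nat.cast_nonneg n
    have h : 1 / ((n : ℝ) + 10 + 1) ^ 3 ≤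
        1 / (2 * ((n : ℝ) + 10) * (n + 11)) - 1 / (2 * ((n : ℝ) + 1 + 10) * (n + 1 + 11)) := by
      have e : 1 / (2 * ((n : ℝ) + 10) * (n + 11)) - 1 / (2 * ((n : ℝ) + 1 + 10) * (n + 1 + 11)) =
          1 / ((n + 10) * (n + 11) * (n + 12)) := by
        have : (n : ℝ) + 1 + 11 ≠ 0 := by positivity
        have : (n : ℝ) + 1 + 10 ≠ 0 := by positivity
        field_simp
        ring
      rw [e]
      apply one_div_le_one_div_of_le (by positivity)
      nlinarith
    linarith

lemma zetaThree_lt : zetaThree < 1.2025 := by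
  refine lt_of_le_of_lt (le_of_tendsto' ((tendsto_add_atTop_iff_nat 10).2
    summable_inv_succ_cube.hasSum.tendsto_sum_nat) fun n => (sum_inv_cube_le n).trans ?_)
    (by norm_num : (1.2022 : ℝ) < 1.2025)
  have : 0 ≤ 1 / (2 * ((n : ℝ) + 10) * (n + 11)) := by positivity
  linarith

lemma rpow_three_halves {x : ℝ} (hx : 0 ≤ x) : x ^ (3 / 2 : ℝ) = √x ^ 3 := by
  rw [Real.sqrt_eq_rpow, ← Real.rpow_natCast, ← Real.rpow_mul hx]
  norm_num

lemma limitVar_bounds :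
    9.4202 < 16 - 2 * Real.pi ^ 2 / 3 ∧ 16 - 2 * Real.pi ^ 2 / 3 < 9.4203 := by
  have h1 := Real.pi_gt_d6
  have h2 := Real.pi_lt_d6
  constructor <;> nlinarith

lemma limitSkewness_bounds : 1.633 < limitSkewness ∧ limitSkewness < 1.634 := by
  obtain ⟨h1, h2⟩ := limitVar_bounds
  rw [limitSkewness, rpow_three_halves (by linarith)]
  set x := 16 - 2 * Real.pi ^ 2 / 3
  have hx : √x ^ 3 = √x * x := by rw [pow_succ', Real.sq_sqrt (by linarith)]
  have hl : 3.0692 < √x := Real.lt_sqrt_of_sq_lt (by norm_num; linarith)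
  have hu : √x < 3.0693 := (Real.sqrt_lt' (by norm_num)).2 (by norm_num; linarith)
  have hp : 0 < √x * x := by positivity
  have z1 := zetaThree_gt
  have z2 := zetaThree_lt
  rw [hx, lt_div_iff₀ hp, div_lt_iff₀ hp]
  constructor <;> nlinarith

/-! ### The law of the Zagreb index -/

lemma integral_zagrebLaw {E : Type*} [NormedAddCommGroup E] [NormedSpace ℝ E] [CompleteSpace E]
    (i : ℕ) {f : ℝ → E} (hf : StronglyMeasurable f) :
    ∫ x, f x ∂zagrebLaw (i + 2) = treeMean i fun G => f (powSum G 2) := by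
  let _ : MeasurableSpace (SimpleGraph (Fin (i + 2))) := ⊤
  have hg : Measurable fun G : SimpleGraph (Fin (i + 2)) => (zagrebIndex G : ℝ) :=
    measurable_from_top
  rw [zagrebLaw, ← PMF.toMeasure_map _ _ hg, integral_map hg.aemeasurable hf.aestronglyMeasurable,
    PMF.integral_eq_sum]
  simp only [zagrebIndex_eq_powSum]
  rfl

lemma integrable_zagrebLaw (i : ℕ) {f : ℝ → ℝ} (hf : Measurable f) :
    Integrable f (zagrebLaw (i + 2)) := by
  let _ : MeasurableSpace (SimpleGraph (Fin (i + 2))) := ⊤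
  have hg : Measurable fun G : SimpleGraph (Fin (i + 2)) => (zagrebIndex G : ℝ) :=
    measurable_from_top
  rw [zagrebLaw, ← PMF.toMeasure_map _ _ hg]
  exact (integrable_map_measure hf.aestronglyMeasurable hg.aemeasurable).2 Integrable.of_finite

lemma powSum_two_eq {i : ℕ} (G : SimpleGraph (Fin (i + 2))) :
    powSum G 2 = (i + 1) * (mart i G + 2 * harm 1 i) := by
  rw [mart]
  field_simp
  ring

lemma treeMean_mart' (i : ℕ) : treeMean i (fun G => mart i G) = 0 := treeMean_mart i

lemma integral_id_zagrebLaw (i : ℕ) :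
    ∫ x, x ∂zagrebLaw (i + 2) = (i + 1) * (2 * harm 1 i) := by
  rw [integral_zagrebLaw i (f := fun x => x) stronglyMeasurable_id]
  simp only [powSum_two_eq]
  rw [treeMean_const_mul, treeMean_add, treeMean_mart', treeMean_const, zero_add]

lemma integral_sq_zagrebLaw (i : ℕ) :
    ∫ x, x ^ 2 ∂zagrebLaw (i + 2) = ((i : ℝ) + 1) ^ 2 * (martVar i + 4 * harm 1 i ^ 2) := by
  rw [integral_zagrebLaw i (f := fun x => x ^ 2) (by fun_prop)]
  have e : ∀ G : SimpleGraph (Fin (i + 2)), powSum G 2 ^ 2 = ((i : ℝ) + 1) ^ 2 *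
      (mart i G ^ 2 + 4 * harm 1 i * mart i G + 4 * harm 1 i ^ 2) := fun G => by
    rw [powSum_two_eq]; ring
  simp only [e]
  rw [treeMean_const_mul, treeMean_add, treeMean_add, treeMean_const_mul, treeMean_mart',
    treeMean_const, mul_zero, add_zero]
  rfl

lemma integral_cube_zagrebLaw (i : ℕ) :
    ∫ x, x ^ 3 ∂zagrebLaw (i + 2) =
      ((i : ℝ) + 1) ^ 3 * (martThird i + 6 * harm 1 i * martVar i + 8 * harm 1 i ^ 3) := by
  rw [integral_zagrebLaw i (f := fun x => x ^ 3) (by fun_prop)]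
  have e : ∀ G : SimpleGraph (Fin (i + 2)), powSum G 2 ^ 3 = ((i : ℝ) + 1) ^ 3 *
      (mart i G ^ 3 + 6 * harm 1 i * mart i G ^ 2 + 12 * harm 1 i ^ 2 * mart i G
        + 8 * harm 1 i ^ 3) := fun G => by
    rw [powSum_two_eq]; ring
  simp only [e]
  rw [treeMean_const_mul, treeMean_add, treeMean_add, treeMean_add, treeMean_const_mul,
    treeMean_const_mul, treeMean_mart', treeMean_const, mul_zero, add_zero]
  rfl

lemma third_central_moment_zagrebLaw (i : ℕ) :
    (∫ x, x ^ 3 ∂zagrebLaw (i + 2))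
      - 3 * (∫ x, x ∂zagrebLaw (i + 2)) * (∫ x, x ^ 2 ∂zagrebLaw (i + 2))
      + 2 * (∫ x, x ∂zagrebLaw (i + 2)) ^ 3 = ((i : ℝ) + 1) ^ 3 * martThird i := by
  rw [integral_id_zagrebLaw, integral_sq_zagrebLaw, integral_cube_zagrebLaw]
  ring

lemma variance_zagrebLaw (i : ℕ) :
    variance id (zagrebLaw (i + 2)) = ((i : ℝ) + 1) ^ 2 * martVar i := by
  rw [variance_eq_integral measurable_id.aemeasurable]
  simp only [id]
  rw [integral_id_zagrebLaw, integral_zagrebLaw i (f := fun x => (x - _) ^ 2) (by fun_prop)]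
  simp only [powSum_two_eq]
  rw [martVar, ← treeMean_const_mul]
  congr 1
  funext G
  ring

lemma standardize_zagrebLaw {i : ℕ} (G : SimpleGraph (Fin (i + 2))) :
    standardize (zagrebLaw (i + 2)) (powSum G 2) = mart i G / √(martVar i) := by
  rw [standardize, integral_id_zagrebLaw, variance_zagrebLaw, Real.sqrt_mul (by positivity),
    Real.sqrt_sq (by positivity), powSum_two_eq, ← mul_sub, add_sub_cancel_right,
    mul_div_mul_left _ _ (by positivity)]

lemma integral_standardizedZagrebLaw {E : Type*} [NormedAddCommGroup E] [NormedSpace ℝ E]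
    [CompleteSpace E] (i : ℕ) {f : ℝ → E} (hf : StronglyMeasurable f) :
    ∫ x, f x ∂(standardizedZagrebLaw (i + 2) : Measure ℝ) =
      treeMean i fun G => f (mart i G / √(martVar i)) := by
  have hm := measurable_standardize (zagrebLaw (i + 2))
  rw [standardizedZagrebLaw, ProbabilityMeasure.coe_mk,
    integral_map hm.aemeasurable hf.aestronglyMeasurable,
    integral_zagrebLaw i (f := fun x => f (standardize _ x)) (hf.comp_measurable hm)]
  simp only [standardize_zagrebLaw]

lemma integrable_standardizedZagrebLaw (i : ℕ) {f : ℝ → ℝ} (hf : Measurable f) :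
    Integrable f (standardizedZagrebLaw (i + 2) : Measure ℝ) := by
  have hm := measurable_standardize (zagrebLaw (i + 2))
  rw [standardizedZagrebLaw, ProbabilityMeasure.coe_mk,
    integrable_map_measure hf.aestronglyMeasurable hm.aemeasurable]
  exact integrable_zagrebLaw i (hf.comp hm)

lemma integral_pow_standardizedZagrebLaw (i k : ℕ) :
    ∫ x, x ^ k ∂(standardizedZagrebLaw (i + 2) : Measure ℝ) =
      (treeMean i fun G => mart i G ^ k) / √(martVar i) ^ k := by
  rw [integral_standardizedZagrebLaw i (f := fun x => x ^ k) (by fun_prop), div_eq_inv_mul,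
    ← treeMean_const_mul]
  congr 1
  funext G
  rw [div_pow]
  ring

lemma skewness_zagrebLaw (i : ℕ) :
    skewness (zagrebLaw (i + 2)) = martThird i / √(martVar i) ^ 3 := by
  rw [martThird, ← integral_pow_standardizedZagrebLaw, standardizedZagrebLaw,
    ProbabilityMeasure.coe_mk, integral_map (measurable_standardize _).aemeasurable
      (by fun_prop), skewness]

lemma limitVar_pos : 0 < 16 - 2 * Real.pi ^ 2 / 3 := by linarith [limitVar_bounds.1]

lemma tendsto_martThird_div :
    Tendsto (fun i => martThird i / √(martVar i) ^ 3) atTop (𝓝 limitSkewness) := by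
  rw [limitSkewness, rpow_three_halves limitVar_pos.le]
  exact tendsto_martThird.div (tendsto_martVar.sqrt.pow 3)
    (pow_ne_zero 3 (Real.sqrt_pos.2 limitVar_pos).ne')

/-! ### The limit law -/

lemma norm_exp_mul_I_sub_le (a b : ℝ) :
    ‖Complex.exp (a * Complex.I) - Complex.exp (b * Complex.I)‖ ≤ |a - b| := by
  have h : Complex.exp (a * Complex.I) - Complex.exp (b * Complex.I) =
      Complex.exp (b * Complex.I) * (Complex.exp (Complex.I * (a - b : ℝ)) - 1) := by
    rw [mul_sub, mul_one, ← Complex.exp_add]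
    congr 2
    push_cast
    ring
  rw [h, norm_mul, Complex.norm_exp_ofReal_mul_I, one_mul]
  exact Real.norm_exp_I_mul_ofReal_sub_one_le

lemma norm_martChar_sub_le (i : ℕ) (s t : ℝ) :
    ‖martChar i s - martChar i t‖ ≤ |s - t| * (1 + martVar i) := by
  rw [martChar, martChar, treeMean, treeMean, ← pmfMean_sub]
  refine (norm_pmfMean_le _ _).trans ?_
  rw [martVar, ← treeMean_const (i := i) 1, ← treeMean_add, ← treeMean_const_mul]
  refine treeMean_mono fun G _ => (norm_exp_mul_I_sub_le _ _).trans ?_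
  rw [← sub_mul, abs_mul]
  gcongr
  rw [← sq_abs]
  nlinarith [sq_nonneg (|mart i G| - 1), abs_nonneg (mart i G)]

lemma charFun_standardizedZagrebLaw (i : ℕ) (t : ℝ) :
    charFun (standardizedZagrebLaw (i + 2) : Measure ℝ) t = martChar i (t / √(martVar i)) := by
  rw [charFun_apply_real, integral_standardizedZagrebLaw i
    (f := fun x : ℝ => Complex.exp (t * x * Complex.I))
    (by exact (by fun_prop : Continuous fun x : ℝ =>
      Complex.exp (t * x * Complex.I)).stronglyMeasurable), martChar]
  congr 1
  funext G
  push_cast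
  congr 1
  ring

/-- Standardizing moves the argument to t/√(`martVar i`), which converges; the Lipschitz bound on
`martChar`, with bounded constants, absorbs the change. -/
lemma exists_tendsto_charFun_standardizedZagrebLaw (t : ℝ) :
    ∃ z, Tendsto (fun i => charFun (standardizedZagrebLaw (i + 2) : Measure ℝ) t) atTop (𝓝 z) := by
  obtain ⟨z, hz⟩ := exists_tendsto_martChar (t / √(16 - 2 * Real.pi ^ 2 / 3))
  refine ⟨z, ?_⟩
  have h1 : Tendsto (fun i => t / √(martVar i)) atTop (𝓝 (t / √(16 - 2 * Real.pi ^ 2 / 3))) :=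
    tendsto_const_nhds.div tendsto_martVar.sqrt (Real.sqrt_pos.2 limitVar_pos).ne'
  have h2 : Tendsto (fun i => |t / √(martVar i) - t / √(16 - 2 * Real.pi ^ 2 / 3)|
      * (1 + martVar i)) atTop (𝓝 0) := by
    have h := ((h1.sub_const (t / √(16 - 2 * Real.pi ^ 2 / 3))).abs).mul
      (tendsto_martVar.const_add 1)
    rwa [sub_self, abs_zero, zero_mul] at h
  have h3 := (squeeze_zero_norm (fun i => norm_martChar_sub_le i _ _) h2).add hz
  simp only [charFun_standardizedZagrebLaw]
  simpa using h3

lemma skewness_eq_third_moment {m : Measure ℝ} [IsProbabilityMeasure m]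
    (h1 : ∫ x, x ∂m = 0) (h2 : ∫ x, x ^ 2 ∂m = 1) :
    skewness m = ∫ x, x ^ 3 ∂m := by
  have hv : variance id m = 1 := by
    rw [variance_eq_integral measurable_id.aemeasurable]
    simp [h1, h2]
  simp [skewness, standardize, h1, hv]

lemma exists_limit_standardizedZagrebLaw : ∃ ν : ProbabilityMeasure ℝ,
    Tendsto standardizedZagrebLaw atTop (𝓝 ν) ∧ MemLp id 3 (ν : Measure ℝ) ∧
      skewness (ν : Measure ℝ) = limitSkewness := by
  -- Beyond N, standardization divides by more than 1, so the fourth-moment bound for `mart`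
  -- survives it.
  obtain ⟨N, hN⟩ : ∃ N, ∀ i ≥ N, 1 < martVar i :=
    eventually_atTop.1 (tendsto_martVar.eventually_const_lt (by linarith [limitVar_bounds.1]))
  obtain ⟨B, hB⟩ := exists_treeMean_mart_fourth_le
  set P : ℕ → ProbabilityMeasure ℝ := fun k => standardizedZagrebLaw (k + N + 2) with hP
  have hi : ∀ k, Integrable (fun x : ℝ => x ^ 4) (P k : Measure ℝ) := fun k =>
    integrable_standardizedZagrebLaw (k + N) (by fun_prop)
  have hV : ∀ k, 1 < martVar (k + N) := fun k => hN _ (Nat.le_add_left _ _)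
  have hPB : ∀ k, ∫ x, x ^ 4 ∂(P k : Measure ℝ) ≤ B := fun k => by
    rw [integral_pow_standardizedZagrebLaw]
    refine (div_le_self (treeMean_nonneg fun G => by positivity) ?_).trans (hB _)
    exact one_le_pow₀ (Real.one_le_sqrt.2 (hV k).le)
  have hc : ∀ t, ∃ z, Tendsto (fun k => charFun (P k : Measure ℝ) t) atTop (𝓝 z) := fun t => by
    obtain ⟨z, hz⟩ := exists_tendsto_charFun_standardizedZagrebLaw t
    exact ⟨z, (tendsto_add_atTop_iff_nat N).2 hz⟩
  obtain ⟨ν, hν⟩ := exists_tendsto_of_tendsto_charFun hi hPB hc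
  have m1 : ∫ x, x ∂(ν : Measure ℝ) = 0 := by
    have h := tendsto_integral_pow hi hPB hν (k := 1) (by norm_num)
    simp only [hP, integral_pow_standardizedZagrebLaw] at h
    simp only [pow_one, treeMean_mart', zero_div] at h
    exact (tendsto_nhds_unique h tendsto_const_nhds)
  have m2 : ∫ x, x ^ 2 ∂(ν : Measure ℝ) = 1 := by
    have h := tendsto_integral_pow hi hPB hν (k := 2) (by norm_num)
    refine tendsto_nhds_unique h (tendsto_const_nhds.congr fun k => ?_)
    simp only [hP, integral_pow_standardizedZagrebLaw]
    have := hV k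
    rw [Real.sq_sqrt (by linarith), martVar, div_self]
    rw [martVar] at this
    linarith
  have m3 : ∫ x, x ^ 3 ∂(ν : Measure ℝ) = limitSkewness := by
    have h := tendsto_integral_pow hi hPB hν (k := 3) le_rfl
    simp only [hP, integral_pow_standardizedZagrebLaw] at h
    exact tendsto_nhds_unique h ((tendsto_add_atTop_iff_nat N).2 tendsto_martThird_div)
  refine ⟨ν, (tendsto_add_atTop_iff_nat (N + 2)).1 hν,
    memLp_three_of_fourth (integrable_fourth_of_tendsto hi hPB hν), ?_⟩
  rw [skewness_eq_third_moment m1 m2, m3]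

end Port
end

theorem mainTheorem2 :
    Tendsto (fun n : ℕ =>
        ((∫ x, x ^ 3 ∂Port.zagrebLaw n)
          - 3 * (∫ x, x ∂Port.zagrebLaw n) * (∫ x, x ^ 2 ∂Port.zagrebLaw n)
          + 2 * (∫ x, x ∂Port.zagrebLaw n) ^ 3) / (n : ℝ) ^ 3)
      atTop (𝓝 (28 + 16 * Port.zetaThree)) ∧
    Tendsto (fun n : ℕ => Port.skewness (Port.zagrebLaw n)) atTop (𝓝 Port.limitSkewness) ∧
    (1.633 < Port.limitSkewness ∧ Port.limitSkewness < 1.634) ∧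
    ∃ ν : ProbabilityMeasure ℝ,
      Tendsto Port.standardizedZagrebLaw atTop (𝓝 ν) ∧
      MemLp id 3 (ν : Measure ℝ) ∧
      Port.skewness (ν : Measure ℝ) = Port.limitSkewness ∧
      ∀ (m : ℝ) (v : NNReal), (ν : Measure ℝ) ≠ gaussianReal m v := by
  refine ⟨?_, ?_, Port.limitSkewness_bounds, ?_⟩
  · refine (tendsto_add_atTop_iff_nat 2).1 ?_
    -- The exact moment scales as (n-1)^3, the claim as n^3; the ratio tends to 1.
    have hr : Tendsto (fun i : ℕ => ((i : ℝ) + 1) / ((i : ℝ) + 2)) atTop (𝓝 1) := by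
      have h := tendsto_const_nhds (x := (1 : ℝ)).sub
        ((tendsto_add_atTop_iff_nat 2).2 tendsto_one_div_atTop_nhds_zero_nat)
      rw [sub_zero] at h
      refine h.congr fun i => ?_
      have := Port.two_ne i
      push_cast
      field_simp
      ring
    have h := (hr.pow 3).mul Port.tendsto_martThird
    rw [one_pow, one_mul] at h
    refine h.congr fun i => ?_
    rw [Port.third_central_moment_zagrebLaw]
    push_cast
    rw [div_pow]
    ring
  · refine (tendsto_add_atTop_iff_nat 2).1 ?_
    simp only [Port.skewness_zagrebLaw]
    exact Port.tendsto_martThird_div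
  · obtain ⟨ν, h1, h2, h3⟩ := Port.exists_limit_standardizedZagrebLaw
    refine ⟨ν, h1, h2, h3, fun m v hmv => ?_⟩
    have h4 := Port.limitSkewness_bounds.1
    rw [← h3, hmv, Port.skewness_gaussianReal] at h4
    norm_num at h4
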